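/- **Theorem.** For each $n\ge 1$ let $N=N(n)$ be a non-negative integer and let $X_n$ be a random complex $n\times N$ matrix. Assume that $n/N\to c$ for some $c\in(0,\infty)$, and that there are numbers $d_n=o(n^2)$ such that, for every $n$, the index set $\{1,\dots,n\}\times\{1,\dots,N\}$ has a partition $\{P_1,\dots,P_k\}$ with $|P_r|\le d_n$ for all $r$ for which the random vectors $\big((X_n)_{ij}\big)_{(i,j)\in P_r}$, $r=1,\dots,k$, are stochastically independent. Assume moreover that $$\forall_{\varepsilon>0}\quad \lim_{M\to\infty}\limsup_{n\to\infty}\mathbb{P}\Big(\frac1{nN}\sum_{i=1}^n\sum_{j=1}^N |(X_n)_{ij}|^2\,\mathbf 1_{\{|(X_n)_{ij}|^2>M\}}>\varepsilon\Big)=0 .$$ Set $Y_n=\sqrt{X_nX_n^*}$ (the positive semidefinite square root), let $L_n=\frac1n\sum_{i=1}^n\delta_{\lambda_i}$ be the empirical spectral distribution of $\frac1{\sqrt n}Y_n$, where $\lambda_1,\dots,\lambda_n$ are the eigenvalues of $\frac1{\sqrt n}Y_n$ counted with multiplicity, and let $\mathbb{E}L_n$ be the probability measure on $\mathbb{R}$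 given by $(\mathbb{E}L_n)(B)=\mathbb{E}\big(L_n(B)\big)$ for Borel sets $B$. Then for every metric $\rho$ on the set of Borel probability measures on $\mathbb{R}$ that metrizes weak convergence, $$\rho(L_n,\mathbb{E}L_n)\to 0\quad\text{in probability as } n\to\infty .$$ -/

import Mathlib

open MeasureTheory ProbabilityTheory Filter Topology Asymptotics
open scoped Matrix MatrixOrder ComplexOrder ENNReal

noncomputable section

/-! ### Empirical spectral distributions -/

/-- The empirical spectral distribution `(1/n) ∑ δ_{λ_i}` of a Hermitian `n × n` matrix, where
`λ_1, …, λ_n` are its eigenvalues with multiplicity. -/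
def esdMeasure {n : ℕ} (A : Matrix (Fin n) (Fin n) ℂ) (hA : A.IsHermitian) : Measure ℝ :=
  (n : ℝ≥0∞)⁻¹ • ∑ i, Measure.dirac (hA.eigenvalues i)

theorem esdMeasure_isProbabilityMeasure {n : ℕ} [NeZero n] (A : Matrix (Fin n) (Fin n) ℂ)
    (hA : A.IsHermitian) : IsProbabilityMeasure (esdMeasure A hA) := by
  constructor
  have hn : (n : ℝ≥0∞) ≠ 0 := by exact_mod_cast NeZero.ne n
  simp [esdMeasure, ENNReal.inv_mul_cancel hn (ENNReal.natCast_ne_top n)]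

/-- The empirical spectral distribution, as a probability measure on the real line. -/
def esd {n : ℕ} [NeZero n] (A : Matrix (Fin n) (Fin n) ℂ) (hA : A.IsHermitian) :
    ProbabilityMeasure ℝ :=
  ⟨esdMeasure A hA, esdMeasure_isProbabilityMeasure A hA⟩

/-- `√(X X*)`, the positive semidefinite square root of `X X*`. -/
def singularPart {n m : ℕ} (X : Matrix (Fin n) (Fin m) ℂ) : Matrix (Fin n) (Fin n) ℂ :=
  CFC.sqrt (X * Xᴴ)

theorem isHermitian_scaled_singularPart {n m : ℕ} (X : Matrix (Fin n) (Fin m) ℂ) :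
    ((Real.sqrt n)⁻¹ • singularPart X).IsHermitian := by
  have h : (singularPart X).IsHermitian :=
    (Matrix.nonneg_iff_posSemidef.mp (CFC.sqrt_nonneg (X * Xᴴ))).isHermitian
  rw [Matrix.IsHermitian, Matrix.conjTranspose_smul, h.eq]
  simp

/-- The empirical spectral distribution of `Y / √n`, where `Y = √(X X*)`
for an `n × m` matrix `X`. -/
def singularESD {n m : ℕ} [NeZero n] (X : Matrix (Fin n) (Fin m) ℂ) : ProbabilityMeasure ℝ :=
  esd ((Real.sqrt n)⁻¹ • singularPart X) (isHermitian_scaled_singularPart X)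

/-! ### Measurability of the empirical spectral distribution of a random matrix -/

theorem eigenvalues_multiset_cfc {n : ℕ} {A : Matrix (Fin n) (Fin n) ℂ} (hA : A.IsHermitian)
    (f : ℝ → ℝ) {B : Matrix (Fin n) (Fin n) ℂ} (hB : B.IsHermitian) (h : B = cfc f A) :
    Multiset.map hB.eigenvalues Finset.univ.val
      = Multiset.map (fun i => f (hA.eigenvalues i)) Finset.univ.val := by
  have h1 := hB.roots_charpoly_eq_eigenvalues
  have h2 : B.charpoly.roots
      = Multiset.map (fun i => ((f (hA.eigenvalues i) : ℝ) : ℂ)) Finset.univ.val := by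
    rw [h, hA.charpoly_cfc_eq]
    have h4 := Polynomial.roots_multiset_prod_X_sub_C
      (Multiset.map (fun i => ((f (hA.eigenvalues i) : ℝ) : ℂ)) Finset.univ.val)
    rw [Multiset.map_map] at h4
    exact h4
  have h3 := congrArg (Multiset.map Complex.re) (h1.symm.trans h2)
  simpa [Multiset.map_map, Function.comp_def] using h3

theorem sum_eigenvalues_cfc {n : ℕ} {A : Matrix (Fin n) (Fin n) ℂ} (hA : A.IsHermitian)
    (f : ℝ → ℝ) {B : Matrix (Fin n) (Fin n) ℂ} (hB : B.IsHermitian) (h : B = cfc f A)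
    {M : Type*} [AddCommMonoid M] (g : ℝ → M) :
    ∑ i, g (hB.eigenvalues i) = ∑ i, g (f (hA.eigenvalues i)) := by
  have h3 := congrArg (fun s => (Multiset.map g s).sum) (eigenvalues_multiset_cfc hA f hB h)
  simpa [Multiset.map_map, Function.comp_def, Finset.sum] using h3

theorem sum_eigenvalues_pow {n : ℕ} {A : Matrix (Fin n) (Fin n) ℂ} (hA : A.IsHermitian) (k : ℕ) :
    ∑ i, hA.eigenvalues i ^ k = (A ^ k).trace.re := by
  have hB : (A ^ k).IsHermitian := hA.pow k
  have h : A ^ k = cfc (fun x : ℝ => x ^ k) A := (cfc_pow_id A k hA.isSelfAdjoint).symm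
  have h1 := sum_eigenvalues_cfc hA (fun x : ℝ => x ^ k) hB h (fun x : ℝ => x)
  rw [← h1, hB.trace_eq_sum_eigenvalues]
  simp

theorem measurable_pow_entry {Ω : Type*} [MeasurableSpace Ω] {n : ℕ}
    {A : Ω → Matrix (Fin n) (Fin n) ℂ} (hm : ∀ i j, Measurable fun ω => A ω i j) (k : ℕ) :
    ∀ i j, Measurable fun ω => (A ω ^ k) i j := by
  induction k with
  | zero => intro i j; simp
  | succ k ih =>
    intro i j
    simp only [pow_succ, Matrix.mul_apply]
    exact Finset.measurable_sum _ fun l _ => (ih i l).mul (hm l j)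

theorem measurable_sum_eigenvalues {Ω : Type*} [MeasurableSpace Ω] {n : ℕ}
    {A : Ω → Matrix (Fin n) (Fin n) ℂ} (hA : ∀ ω, (A ω).IsHermitian)
    (hm : ∀ i j, Measurable fun ω => A ω i j) (f : ℝ → ℝ) (hf : Continuous f) :
    Measurable fun ω => ∑ i, f ((hA ω).eigenvalues i) := by
  have hpoly (p : Polynomial ℝ) : Measurable fun ω => ∑ i, p.eval ((hA ω).eigenvalues i) := by
    simp only [Polynomial.eval_eq_sum_range]
    have : (fun ω => ∑ i, ∑ k ∈ Finset.range (p.natDegree + 1),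
        p.coeff k * (hA ω).eigenvalues i ^ k) = fun ω => ∑ k ∈ Finset.range (p.natDegree + 1),
        p.coeff k * (A ω ^ k).trace.re := by
      funext ω
      rw [Finset.sum_comm]
      refine Finset.sum_congr rfl fun k _ => ?_
      rw [← Finset.mul_sum, sum_eigenvalues_pow]
    rw [this]
    refine Finset.measurable_sum _ fun k _ => Measurable.const_mul ?_ _
    refine Complex.measurable_re.comp ?_
    simp only [Matrix.trace, Matrix.diag]
    exact Finset.measurable_sum _ fun i _ => measurable_pow_entry hm k i i
  have hex (k : ℕ) : ∃ p : Polynomial ℝ, ∀ x ∈ Set.Icc (-(k : ℝ)) k,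
      |p.eval x - f x| < 1 / ((k : ℝ) + 1) :=
    exists_polynomial_near_of_continuousOn _ _ f hf.continuousOn _ (by positivity)
  choose p hp using hex
  refine measurable_of_tendsto_metrizable (fun k => hpoly (p k)) ?_
  rw [tendsto_pi_nhds]
  intro ω
  refine tendsto_finsetSum _ fun i _ => ?_
  rw [tendsto_iff_dist_tendsto_zero]
  refine squeeze_zero' (Eventually.of_forall fun _ => dist_nonneg) ?_
    tendsto_one_div_add_atTop_nhds_zero_nat
  obtain ⟨K, hK⟩ := exists_nat_ge |(hA ω).eigenvalues i|
  filter_upwards [eventually_ge_atTop K] with k hk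
  have hk' : |(hA ω).eigenvalues i| ≤ k := hK.trans (by exact_mod_cast hk)
  exact (hp k _ (abs_le.mp hk')).le

theorem measurable_esd_of_sums {Ω : Type*} [MeasurableSpace Ω] {n : ℕ} [NeZero n]
    {A : Ω → Matrix (Fin n) (Fin n) ℂ} (hA : ∀ ω, (A ω).IsHermitian)
    (h : ∀ f : ℝ → ℝ, Continuous f → Measurable fun ω => ∑ i, f ((hA ω).eigenvalues i)) :
    Measurable fun ω => esd (A ω) (hA ω) := by
  refine Measurable.subtype_mk ?_
  have := fun ω => esdMeasure_isProbabilityMeasure (A ω) (hA ω)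
  refine Measurable.measure_of_isPiSystem_of_isProbabilityMeasure
    (BorelSpace.measurable_eq.trans borel_eq_generateFrom_isClosed) isPiSystem_isClosed ?_
  intro F hF
  have hlim (ω : Ω) := tendsto_lintegral_thickenedIndicator_of_isClosed
    (esdMeasure (A ω) (hA ω)) hF (δs := fun k : ℕ => 1 / ((k : ℝ) + 1))
    (fun k => by positivity) tendsto_one_div_add_atTop_nhds_zero_nat
  refine measurable_of_tendsto_metrizable (fun k => ?_) (tendsto_pi_nhds.mpr hlim)
  set g := thickenedIndicator (δ := 1 / ((k : ℝ) + 1)) (by positivity) F with hg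
  have hgc : Continuous fun x : ℝ => ((g x : NNReal) : ℝ) :=
    NNReal.continuous_coe.comp g.continuous
  have e : (fun ω => ∫⁻ x, (g x : ℝ≥0∞) ∂(esdMeasure (A ω) (hA ω)))
      = fun ω => (n : ℝ≥0∞)⁻¹ * ENNReal.ofReal (∑ i, ((g ((hA ω).eigenvalues i) : NNReal) : ℝ)) := by
    funext ω
    rw [ENNReal.ofReal_sum_of_nonneg (fun _ _ => NNReal.coe_nonneg _)]
    simp [esdMeasure, lintegral_finsetSum_measure, lintegral_dirac]
  rw [e]
  exact (ENNReal.measurable_ofReal.comp (h _ hgc)).const_mul _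

/-- If the entries of `X` are random variables, then the empirical spectral distribution of
`√(X X*) / √n` is a random probability measure. -/
theorem measurable_singularESD {Ω : Type*} [MeasurableSpace Ω] {n m : ℕ} [NeZero n]
    {X : Ω → Matrix (Fin n) (Fin m) ℂ} (hX : ∀ i j, Measurable fun ω => X ω i j) :
    Measurable fun ω => singularESD (X ω) := by
  refine measurable_esd_of_sums (fun ω => isHermitian_scaled_singularPart (X ω)) fun f hf => ?_
  have hB (ω : Ω) : (X ω * (X ω)ᴴ).IsHermitian := Matrix.isHermitian_mul_conjTranspose_self _
  have hBm : ∀ i j, Measurable fun ω => (X ω * (X ω)ᴴ) i j := by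
    intro i j
    simp only [Matrix.mul_apply, Matrix.conjTranspose_apply]
    exact Finset.measurable_sum _ fun l _ =>
      (hX i l).mul (Complex.continuous_conj.measurable.comp (hX j l))
  have hc (ω : Ω) : (Real.sqrt n)⁻¹ • singularPart (X ω)
      = cfc (fun x : ℝ => (Real.sqrt n)⁻¹ * Real.sqrt x) (X ω * (X ω)ᴴ) := by
    have h0 : (0 : Matrix (Fin n) (Fin n) ℂ) ≤ X ω * (X ω)ᴴ :=
      Matrix.nonneg_iff_posSemidef.mpr (Matrix.posSemidef_self_mul_conjTranspose _)
    rw [cfc_const_mul _ _ _ (Real.continuous_sqrt.continuousOn), singularPart,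
      CFC.sqrt_eq_real_sqrt _ h0, cfcₙ_eq_cfc]
  have e : (fun ω => ∑ i, f ((isHermitian_scaled_singularPart (X ω)).eigenvalues i))
      = fun ω => ∑ i, f ((Real.sqrt n)⁻¹ * Real.sqrt ((hB ω).eigenvalues i)) := by
    funext ω
    exact sum_eigenvalues_cfc (hB ω) _ (isHermitian_scaled_singularPart (X ω)) (hc ω) f
  rw [e]
  exact measurable_sum_eigenvalues hB hBm (fun x => f ((Real.sqrt n)⁻¹ * Real.sqrt x))
    (hf.comp (continuous_const.mul Real.continuous_sqrt))

/-! ### The mean of a random probability measure -/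

/-- The mean `𝔼 μ` of a random probability measure `μ` on the real line:
`(𝔼 μ)(B) = 𝔼 (μ(B))` for every Borel set `B`. -/
def meanMeasure {Ω : Type*} [MeasurableSpace Ω] (P : Measure Ω) [IsProbabilityMeasure P]
    (μ : Ω → ProbabilityMeasure ℝ) (hμ : Measurable μ) : ProbabilityMeasure ℝ :=
  ⟨P.bind fun ω => (μ ω : Measure ℝ), by
    constructor
    have h : Measurable fun ω => (μ ω : Measure ℝ) := measurable_subtype_coe.comp hμ
    rw [Measure.bind_apply MeasurableSet.univ h.aemeasurable]
    simp⟩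

theorem meanMeasure_apply {Ω : Type*} [MeasurableSpace Ω] (P : Measure Ω) [IsProbabilityMeasure P]
    (μ : Ω → ProbabilityMeasure ℝ) (hμ : Measurable μ) {B : Set ℝ} (hB : MeasurableSet B) :
    (meanMeasure P μ hμ : Measure ℝ) B = ∫⁻ ω, (μ ω : Measure ℝ) B ∂P :=
  Measure.bind_apply hB (measurable_subtype_coe.comp hμ).aemeasurable

/-! ### Hypotheses -/

/-- The property `𝒮(d)`: the index set of the random `n × m` matrix `X` can be partitioned into
blocks with at most `d` elements such that the subfamilies of entries indexed by the different
blocks are independent random vectors. -/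
def HasIndependentBlocks {Ω : Type*} [MeasurableSpace Ω] (P : Measure Ω) {n m : ℕ}
    (X : Ω → Matrix (Fin n) (Fin m) ℂ) (d : ℝ) : Prop :=
  ∃ π : Finpartition (Finset.univ : Finset (Fin n × Fin m)),
    (∀ B ∈ π.parts, (B.card : ℝ) ≤ d) ∧
    iIndepFun (fun (B : {B // B ∈ π.parts}) (ω : Ω) (p : {p // p ∈ B.1}) => X ω p.1.1 p.1.2) P

/-- `1/(nm) ∑_{i,j} |x_{ij}|² 1_{|x_{ij}|² > M}` for an `n × m` matrix `x`. -/
def truncatedSecondMoment {n m : ℕ} (x : Matrix (Fin n) (Fin m) ℂ) (M : ℝ) : ℝ :=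
  1 / ((n : ℝ) * (m : ℝ)) * ∑ i, ∑ j, if M < ‖x i j‖ ^ 2 then ‖x i j‖ ^ 2 else 0

/-- `d` is a metric on the set of probability measures on the real line that metrizes weak
convergence. -/
structure MetrizesWeakConvergence (d : ProbabilityMeasure ℝ → ProbabilityMeasure ℝ → ℝ) :
    Prop where
  eq_zero_iff : ∀ μ ν, d μ ν = 0 ↔ μ = ν
  symm : ∀ μ ν, d μ ν = d ν μ
  triangle : ∀ μ ν ρ, d μ ρ ≤ d μ ν + d ν ρ
  tendsto_iff : ∀ (μs : ℕ → ProbabilityMeasure ℝ) (μ : ProbabilityMeasure ℝ),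
    Tendsto μs atTop (𝓝 μ) ↔ Tendsto (fun k => d (μs k) μ) atTop (𝓝 0)

end

/-! The singular-value distribution is tested against `x ↦ √(x² + u)`. The resulting statistic
`sqrtStat u` is, up to scaling, the trace of `√(X X* + nu)`, i.e. the nuclear norm of `X` with an
extra block `√(nu)·1` appended. It is therefore convex in the entries, and its subgradients have
norm at most `1/n` (`exists_subgradient_sqrtStat`).

Convexity makes dependence inside blocks harmless. In a one-sided Efron–Stein inequality
(`variance_pi_le_of_sum_sq_le`), a single subgradient at the current point bounds the decreases
caused by resampling every block. For entries of squared modulus at most `M`, Cauchy–Schwarz on each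
block and summation over blocks give a variance of at most `4 M d / n²`, which tends to zero for `d
= o(n²)`. The Lipschitz constant alone would leave a factor equal to the number of blocks.

Unbounded entries are truncated. The Lipschitz bound controls the error by the truncated second
moment, which is small with high probability. Differences of two such statistics are bounded, so the
exceptional event contributes little to their means, and no moment of the entries is needed
(`measure_deviation_le`).

The differences `hypotDiff q` with rational `q > 1` suffice for weak convergence on the half-line: a
closed linear space containing them contains their `u`-derivatives, hence all odd powers of `1/√(x²
+ 2)`, and Weierstrass approximation does the rest (`tendsto_of_tendsto_integral_hypotDiff`).
Finally, the mean measures are tight by a second-moment bound, and a subsequence argument with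
Prokhorov's theorem passes from these countably many statistics to an arbitrary metric
(`tendsto_measure_metric_gt`). -/

noncomputable section

/-! ### The Efron–Stein inequality -/

section EfronStein

variable {κ E : Type*} [Fintype κ] [MeasurableSpace E] (ν : κ → Measure E)
  [∀ i, IsProbabilityMeasure (ν i)]

theorem measurePreserving_pi_fst :
    MeasurePreserving (fun (w : κ → E × E) i => (w i).1) (Measure.pi fun i => (ν i).prod (ν i))
      (Measure.pi ν) :=
  measurePreserving_pi _ _ fun _ => measurePreserving_fst

theorem integral_mul_pi_prod_self (f : (κ → E) → ℝ) :
    ∫ w, f (fun i => (w i).1) * f (fun i => (w i).2) ∂(Measure.pi fun i => (ν i).prod (ν i))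
      = (∫ x, f x ∂(Measure.pi ν)) ^ 2 := by
  have hmp : MeasurePreserving (fun (w : κ → E × E) => ((fun i => (w i).1), fun i => (w i).2))
      (Measure.pi fun i => (ν i).prod (ν i)) ((Measure.pi ν).prod (Measure.pi ν)) :=
    measurePreserving_arrowProdEquivProdArrow E E κ ν ν
  have hemb : MeasurableEmbedding
      (fun (w : κ → E × E) => ((fun i => (w i).1), fun i => (w i).2)) :=
    (MeasurableEquiv.arrowProdEquivProdArrow E E κ).measurableEmbedding
  rw [sq, ← integral_prod_mul, ← hmp.integral_comp hemb]

variable [DecidableEq κ]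

/-- Exchange the two components of every coordinate whose index lies in `T`. -/
def coordSwap {κ E : Type*} [DecidableEq κ] (T : Finset κ) (w : κ → E × E) : κ → E × E :=
  fun i => (if i ∈ T then Prod.swap else id) (w i)

theorem coordSwap_coordSwap {κ E : Type*} [DecidableEq κ] (S T : Finset κ) (w : κ → E × E) :
    coordSwap S (coordSwap T w) = coordSwap (symmDiff S T) w := by
  funext i
  by_cases hS : i ∈ S <;> by_cases hT : i ∈ T <;> simp [coordSwap, hS, hT, Finset.mem_symmDiff]

theorem measurePreserving_coordSwap (T : Finset κ) :
    MeasurePreserving (coordSwap (E := E) T) (Measure.pi fun i => (ν i).prod (ν i))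
      (Measure.pi fun i => (ν i).prod (ν i)) := by
  refine measurePreserving_pi _ _ (f := fun i => if i ∈ T then Prod.swap else id) fun i => ?_
  split_ifs
  · exact Measure.measurePreserving_swap
  · exact MeasurePreserving.id _

/-- A one-sided **Efron–Stein inequality**: the variance of a bounded function of independent
variables is at most a uniform bound for the sum of the squared positive parts of its increments
under resampling of single coordinates. -/
theorem variance_pi_le_of_sum_sq_le {f : (κ → E) → ℝ} (hf : Measurable f) {C : ℝ}
    (hC : ∀ x, |f x| ≤ C) {K : ℝ}
    (hK : ∀ x y : κ → E, ∑ i, (max (f x - f (Function.update x i (y i))) 0) ^ 2 ≤ K) :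
    Var[f; Measure.pi ν] ≤ K := by
  set Q := Measure.pi fun i => (ν i).prod (ν i) with hQ
  -- Here `a T` is `f` after the coordinates in `T` have been replaced by independent copies. Thus
  -- `a ∅` and `a univ` are independent and equidistributed, and the variance `E[a ∅ ²] - E[a ∅ · a
  -- univ]` telescopes as coordinates are inserted one by one.
  let a (T : Finset κ) (w : κ → E × E) : ℝ := f fun i => (coordSwap T w i).1
  have ha_meas (T) : Measurable (a T) := hf.comp
    ((measurePreserving_pi_fst ν).measurable.comp (measurePreserving_coordSwap ν T).measurable)
  have ha_bd (T w) : |a T w| ≤ C := hC _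
  have ha_comp (S T w) : a S (coordSwap T w) = a (symmDiff S T) w := by
    simp only [a, coordSwap_coordSwap]
  have integrable_of_bdd {g : (κ → E × E) → ℝ} (hg : Measurable g) (D : ℝ) (hD : ∀ w, |g w| ≤ D) :
      Integrable g Q := Integrable.of_bound hg.aestronglyMeasurable D (ae_of_all _ hD)
  have hinv (T : Finset κ) {g : (κ → E × E) → ℝ} (hg : Measurable g) :
      ∫ w, g (coordSwap T w) ∂Q = ∫ w, g w ∂Q := by
    have h := measurePreserving_coordSwap ν T
    rw [← hQ] at h
    conv_rhs => rw [← h.map_eq]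
    rw [integral_map h.measurable.aemeasurable hg.aestronglyMeasurable]
  have hmul (S T) : Integrable (fun w => a S w * a T w) Q := by
    refine integrable_of_bdd ((ha_meas S).mul (ha_meas T)) (C * C) fun w => ?_
    rw [abs_mul]
    exact mul_le_mul (ha_bd _ _) (ha_bd _ _) (abs_nonneg _) ((abs_nonneg _).trans (ha_bd ∅ w))
  have hsq (S T) : Integrable (fun w => (a S w - a T w) ^ 2) Q := by
    have : (fun w => (a S w - a T w) ^ 2)
        = fun w => a S w * a S w + a T w * a T w - 2 * (a S w * a T w) := by
      funext w; ring
    rw [this]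
    exact ((hmul S S).add (hmul T T)).sub ((hmul S T).const_mul 2)
  have hpos (S T) : Integrable (fun w => (max (a S w - a T w) 0) ^ 2) Q := by
    refine (hsq S T).mono
      ((((ha_meas S).sub (ha_meas T)).max measurable_const).pow_const 2).aestronglyMeasurable
      (ae_of_all _ fun w => ?_)
    rw [Real.norm_of_nonneg (sq_nonneg _), Real.norm_of_nonneg (sq_nonneg _)]
    exact sq_le_sq.mpr (by
      rw [abs_of_nonneg (le_max_right _ _)]
      exact max_le (le_abs_self _) (abs_nonneg _))
  -- Swapping coordinate `i` symmetrises the left side to half the mean of `(a ∅ - a {i}) (a T - a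
  -- (insert i T))`. By `2xy ≤ x² + y²`, and since swapping `T` shows that both squares have the
  -- same mean, this is at most half the mean of `(a ∅ - a {i})²`. Swapping `i` once more shows that
  -- the positive part carries exactly half of that mean square.
  have hstep (i : κ) (T : Finset κ) (hi : i ∉ T) :
      ∫ w, (a ∅ w * a T w - a ∅ w * a (insert i T) w) ∂Q
        ≤ ∫ w, (max (a ∅ w - a {i} w) 0) ^ 2 ∂Q := by
    have e1 : symmDiff T {i} = insert i T := by
      ext j; by_cases hj : j = i <;> simp [Finset.mem_symmDiff, hj, hi]
    have e2 : symmDiff (insert i T) {i} = T := by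
      rw [← e1, symmDiff_assoc]; simp
    have e3 : symmDiff {i} T = insert i T := by rw [symmDiff_comm, e1]
    have e4 : symmDiff ∅ T = T := bot_symmDiff T
    have e5 : symmDiff ∅ ({i} : Finset κ) = {i} := bot_symmDiff _
    have e6 : symmDiff {i} ({i} : Finset κ) = ∅ := symmDiff_self _
    have h1 := hinv {i} (g := fun w => a ∅ w * a T w - a ∅ w * a (insert i T) w)
      (((ha_meas _).mul (ha_meas _)).sub ((ha_meas _).mul (ha_meas _)))
    have h2 := hinv T (g := fun w => (a ∅ w - a {i} w) ^ 2)
      (((ha_meas _).sub (ha_meas _)).pow_const 2)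
    have h3 := hinv {i} (g := fun w => (max (a ∅ w - a {i} w) 0) ^ 2)
      ((((ha_meas _).sub (ha_meas _)).max measurable_const).pow_const 2)
    simp only [ha_comp, e1, e2, e3, e4, e5, e6] at h1 h2 h3
    have h4 : ∫ w, (a ∅ w - a {i} w) ^ 2 ∂Q
        = 2 * ∫ w, (max (a ∅ w - a {i} w) 0) ^ 2 ∂Q := by
      have : (fun w => (a ∅ w - a {i} w) ^ 2) = fun w =>
          (max (a ∅ w - a {i} w) 0) ^ 2 + (max (a {i} w - a ∅ w) 0) ^ 2 := by
        funext w
        rcases le_total (a ∅ w) (a {i} w) with h | h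
        · rw [max_eq_right (by linarith), max_eq_left (by linarith)]; ring
        · rw [max_eq_left (by linarith), max_eq_right (by linarith)]; ring
      rw [this, integral_add (hpos _ _) (hpos _ _), h3]
      ring
    have h5 : ∫ w, 4 * (a ∅ w * a T w - a ∅ w * a (insert i T) w) ∂Q
        = ∫ w, 2 * ((a ∅ w - a {i} w) * (a T w - a (insert i T) w)) ∂Q := by
      have hA : Integrable (fun w => a ∅ w * a T w - a ∅ w * a (insert i T) w) Q :=
        (hmul _ _).sub (hmul _ _)
      have hB : Integrable (fun w => a {i} w * a (insert i T) w - a {i} w * a T w) Q :=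
        (hmul _ _).sub (hmul _ _)
      have : (fun w => 2 * ((a ∅ w - a {i} w) * (a T w - a (insert i T) w))) = fun w =>
          2 * (a ∅ w * a T w - a ∅ w * a (insert i T) w)
            + 2 * (a {i} w * a (insert i T) w - a {i} w * a T w) := by
        funext w; ring
      rw [this, integral_add (hA.const_mul 2) (hB.const_mul 2), integral_const_mul,
        integral_const_mul, integral_const_mul, h1]
      ring
    have h6 : ∫ w, 2 * ((a ∅ w - a {i} w) * (a T w - a (insert i T) w)) ∂Q
        ≤ ∫ w, ((a ∅ w - a {i} w) ^ 2 + (a T w - a (insert i T) w) ^ 2) ∂Q := by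
      refine integral_mono ?_ ((hsq _ _).add (hsq _ _)) fun w => ?_
      · have : (fun w => 2 * ((a ∅ w - a {i} w) * (a T w - a (insert i T) w))) = fun w =>
            2 * ((a ∅ w * a T w - a ∅ w * a (insert i T) w)
              + (a {i} w * a (insert i T) w - a {i} w * a T w)) := by
          funext w; ring
        rw [this]
        exact (((hmul _ _).sub (hmul _ _)).add ((hmul _ _).sub (hmul _ _))).const_mul 2
      · have := sq_nonneg ((a ∅ w - a {i} w) - (a T w - a (insert i T) w))
        simp only
        linarith
    rw [integral_add (hsq _ _) (hsq _ _), h2, h4] at h6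
    rw [← h5, integral_const_mul] at h6
    linarith
  have hsum (T : Finset κ) : ∫ w, (a ∅ w * a ∅ w - a ∅ w * a T w) ∂Q
      ≤ ∑ i ∈ T, ∫ w, (max (a ∅ w - a {i} w) 0) ^ 2 ∂Q := by
    induction T using Finset.induction_on with
    | empty => simp
    | insert i T hi ih =>
      rw [Finset.sum_insert hi]
      have e : (fun w => a ∅ w * a ∅ w - a ∅ w * a (insert i T) w) = fun w =>
          (a ∅ w * a T w - a ∅ w * a (insert i T) w) + (a ∅ w * a ∅ w - a ∅ w * a T w) := by
        funext w; ring
      have hA : Integrable (fun w => a ∅ w * a T w - a ∅ w * a (insert i T) w) Q :=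
        (hmul _ _).sub (hmul _ _)
      have hB : Integrable (fun w => a ∅ w * a ∅ w - a ∅ w * a T w) Q :=
        (hmul _ _).sub (hmul _ _)
      rw [e, integral_add hA hB]
      exact add_le_add (hstep i T hi) ih
  have hmain := hsum Finset.univ
  rw [integral_sub (hmul _ _) (hmul _ _), ← integral_finsetSum _ fun i _ => hpos _ _] at hmain
  have hle : ∫ w, ∑ i, (max (a ∅ w - a {i} w) 0) ^ 2 ∂Q ≤ ∫ _w, K ∂Q := by
    refine integral_mono (integrable_finsetSum _ fun i _ => hpos _ _) (integrable_const _)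
      fun w => ?_
    refine le_of_eq_of_le (Finset.sum_congr rfl fun i _ => ?_)
      (hK (fun i => (w i).1) fun i => (w i).2)
    have : (fun j => (coordSwap {i} w j).1)
        = Function.update (fun i => (w i).1) i (w i).2 := by
      funext j
      by_cases hj : j = i
      · subst hj; simp [coordSwap]
      · simp [coordSwap, hj]
    simp only [a, this]
    simp [coordSwap]
  have hfst (w : κ → E × E) : a ∅ w = f fun i => (w i).1 := by simp [a, coordSwap]
  have hsnd (w : κ → E × E) : a Finset.univ w = f fun i => (w i).2 := by simp [a, coordSwap]
  have hsecond : ∫ w, a ∅ w * a ∅ w ∂Q = ∫ x, f x ^ 2 ∂(Measure.pi ν) := by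
    have h := measurePreserving_pi_fst ν
    rw [← h.map_eq, integral_map h.measurable.aemeasurable (hf.pow_const 2).aestronglyMeasurable]
    simp only [hfst, sq]
    rfl
  have hprod : ∫ w, a ∅ w * a Finset.univ w ∂Q = (∫ x, f x ∂(Measure.pi ν)) ^ 2 := by
    simp only [hfst, hsnd]
    exact integral_mul_pi_prod_self ν f
  rw [variance_eq_sub (MemLp.of_bound hf.aestronglyMeasurable C (ae_of_all _ hC))]
  rw [hsecond, hprod] at hmain
  simpa using hmain.trans hle

end EfronStein

/-! ### The trace of `√(X X* + v)` -/

section SqrtTrace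

variable {n m : ℕ}

theorem eigenvalues_mul_conjTranspose_self_nonneg (X : Matrix (Fin n) (Fin m) ℂ) (i : Fin n) :
    0 ≤ (Matrix.isHermitian_mul_conjTranspose_self X).eigenvalues i :=
  (Matrix.posSemidef_self_mul_conjTranspose X).eigenvalues_nonneg i

theorem integral_singularESD [NeZero n] (X : Matrix (Fin n) (Fin m) ℂ) (f : ℝ → ℝ) :
    ∫ x, f x ∂(singularESD X : Measure ℝ) = (n : ℝ)⁻¹ * ∑ i, f ((Real.sqrt n)⁻¹ *
      Real.sqrt ((Matrix.isHermitian_mul_conjTranspose_self X).eigenvalues i)) := by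
  have hc : (Real.sqrt n)⁻¹ • singularPart X
      = cfc (fun x : ℝ => (Real.sqrt n)⁻¹ * Real.sqrt x) (X * Xᴴ) := by
    have h0 : (0 : Matrix (Fin n) (Fin n) ℂ) ≤ X * Xᴴ :=
      Matrix.nonneg_iff_posSemidef.mpr (Matrix.posSemidef_self_mul_conjTranspose _)
    rw [cfc_const_mul _ _ _ (Real.continuous_sqrt.continuousOn), singularPart,
      CFC.sqrt_eq_real_sqrt _ h0, cfcₙ_eq_cfc]
  have hs := sum_eigenvalues_cfc (Matrix.isHermitian_mul_conjTranspose_self X) _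
    (isHermitian_scaled_singularPart X) hc f
  rw [← hs]
  change ∫ x, f x ∂(esdMeasure _ _) = _
  rw [esdMeasure, integral_smul_measure, integral_finsetSum_measure fun i _ => by
    exact integrable_dirac (by simp)]
  simp

/-- The positive definite square root of `X X* + v`. -/
theorem exists_posDef_sqrt_add (X : Matrix (Fin n) (Fin m) ℂ) {v : ℝ} (hv : 0 < v) :
    ∃ R : Matrix (Fin n) (Fin n) ℂ, R.PosDef ∧ R * R = X * Xᴴ + (v : ℂ) • 1 ∧
      R.trace = ((∑ i, Real.sqrt
        ((Matrix.isHermitian_mul_conjTranspose_self X).eigenvalues i + v) : ℝ) : ℂ) := by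
  set A := X * Xᴴ with hA
  have hAH : A.IsHermitian := Matrix.isHermitian_mul_conjTranspose_self X
  have hAp : A.PosSemidef := Matrix.posSemidef_self_mul_conjTranspose X
  have hspec : ∀ x ∈ spectrum ℝ A, 0 ≤ x := fun x hx =>
    spectrum_nonneg_of_nonneg (Matrix.nonneg_iff_posSemidef.mpr hAp) hx
  have hcont : Continuous fun x : ℝ => Real.sqrt (x + v) := by fun_prop
  have hsa : IsSelfAdjoint A := hAH.isSelfAdjoint
  set R := cfc (fun x : ℝ => Real.sqrt (x + v)) A with hR
  have hRR : R * R = A + (v : ℂ) • 1 := by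
    rw [hR, ← cfc_mul _ _ _ hcont.continuousOn hcont.continuousOn]
    have : cfc (fun x : ℝ => Real.sqrt (x + v) * Real.sqrt (x + v)) A
        = cfc (fun x : ℝ => x + v) A :=
      cfc_congr fun x hx => Real.mul_self_sqrt (by linarith [hspec x hx])
    rw [this, cfc_add_const v (fun x => x) A, cfc_id' ℝ A, Algebra.algebraMap_eq_smul_one]
    simp
  have hRp : R.PosSemidef :=
    Matrix.nonneg_iff_posSemidef.mp (cfc_nonneg fun x _ => Real.sqrt_nonneg _)
  have hpd : (R * R).PosDef := by
    rw [hRR]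
    refine Matrix.PosDef.posSemidef_add hAp ?_
    exact Matrix.PosDef.one.smul (by exact_mod_cast hv)
  refine ⟨R, ?_, hRR, ?_⟩
  · exact hRp.posDef_iff_isUnit.mpr (isUnit_of_mul_isUnit_left hpd.isUnit)
  · rw [hRp.isHermitian.trace_eq_sum_eigenvalues]
    have := sum_eigenvalues_cfc hAH (fun x : ℝ => Real.sqrt (x + v)) hRp.isHermitian hR
      (fun x => (x : ℂ))
    simpa using this

/-- This is nuclear-norm duality for the augmented matrices `W_X = (X, √v·1)` and `W_Z = (Z, √v·1)`,
with `W_X W_X* = R²` and `W_Z W_Z* = S²`. The polar factors `U_X = R⁻¹ W_X` and `U_Z = S⁻¹ W_Z`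
satisfy `U U* = 1`, so `0 ≤ tr S (U_Z - U_X)(U_Z - U_X)*` says `Re tr (W_Z U_X*) ≤ tr S`, with
equality when `Z = X`. On subtraction the constant blocks cancel. Below, `D` and `D'` are the two
blocks of `U_Z - U_X`, the second without its factor `√v`. -/
theorem re_trace_sub_le {X Z : Matrix (Fin n) (Fin m) ℂ} {R S : Matrix (Fin n) (Fin n) ℂ}
    {v : ℝ} (hv : 0 ≤ v) (hR : R.PosDef) (hS : S.PosDef)
    (hRR : R * R = X * Xᴴ + (v : ℂ) • 1) (hSS : S * S = Z * Zᴴ + (v : ℂ) • 1) :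
    R.trace.re - S.trace.re ≤ ((X - Z) * (R⁻¹ * X)ᴴ).trace.re := by
  have hRi : R⁻¹ * R = 1 := Matrix.nonsing_inv_mul _ ((Matrix.isUnit_iff_isUnit_det _).mp hR.isUnit)
  have hRi' : R * R⁻¹ = 1 := Matrix.mul_nonsing_inv _ ((Matrix.isUnit_iff_isUnit_det _).mp hR.isUnit)
  have hSi : S⁻¹ * S = 1 := Matrix.nonsing_inv_mul _ ((Matrix.isUnit_iff_isUnit_det _).mp hS.isUnit)
  have hSi' : S * S⁻¹ = 1 := Matrix.mul_nonsing_inv _ ((Matrix.isUnit_iff_isUnit_det _).mp hS.isUnit)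
  have hRh : (R⁻¹)ᴴ = R⁻¹ := hR.isHermitian.inv
  have hSh : (S⁻¹)ᴴ = S⁻¹ := hS.isHermitian.inv
  set D := S⁻¹ * Z - R⁻¹ * X with hD
  set D' := S⁻¹ - R⁻¹ with hD'
  have hD'h : D'ᴴ = D' := by rw [hD', Matrix.conjTranspose_sub, hRh, hSh]
  have hpos1 : 0 ≤ (Dᴴ * S * D).trace.re :=
    (Complex.nonneg_iff.mp (hS.posSemidef.conjTranspose_mul_mul_same D).trace_nonneg).1
  have hpos2 : 0 ≤ (D'ᴴ * S * D').trace.re :=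
    (Complex.nonneg_iff.mp (hS.posSemidef.conjTranspose_mul_mul_same D').trace_nonneg).1
  have hXX : X * Xᴴ = R * R - (v : ℂ) • 1 := by rw [hRR]; simp
  have hZZ : Z * Zᴴ = S * S - (v : ℂ) • 1 := by rw [hSS]; simp
  have e0 : S * D = Z - S * R⁻¹ * X := by
    rw [hD, Matrix.mul_sub, ← Matrix.mul_assoc, hSi', Matrix.one_mul, Matrix.mul_assoc]
  have e1 : (Dᴴ * S * D).trace = (S - (v : ℂ) • S⁻¹).trace - (Z * (R⁻¹ * X)ᴴ).trace
      - (R⁻¹ * X * Zᴴ).trace + (S - (v : ℂ) • (S * R⁻¹ * R⁻¹)).trace := by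
    rw [Matrix.mul_assoc, e0, Matrix.trace_mul_comm, hD, Matrix.conjTranspose_sub,
      Matrix.conjTranspose_mul, Matrix.conjTranspose_mul, hRh, hSh, Matrix.sub_mul,
      Matrix.mul_sub, Matrix.mul_sub]
    have a1 : Z * (Zᴴ * S⁻¹) = S - (v : ℂ) • S⁻¹ := by
      rw [← Matrix.mul_assoc, hZZ, Matrix.sub_mul, Matrix.mul_assoc, hSi']
      simp
    have a2 : S * R⁻¹ * X * (Xᴴ * R⁻¹) = S - (v : ℂ) • (S * R⁻¹ * R⁻¹) := by
      have : S * R⁻¹ * X * (Xᴴ * R⁻¹) = S * R⁻¹ * (X * Xᴴ) * R⁻¹ := by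
        simp only [Matrix.mul_assoc]
      rw [this, hXX, Matrix.mul_sub, Matrix.sub_mul]
      have : S * R⁻¹ * (R * R) * R⁻¹ = S * (R⁻¹ * R) * (R * R⁻¹) := by
        simp only [Matrix.mul_assoc]
      rw [this, hRi, hRi']
      simp
    have a3 : (S * R⁻¹ * X * (Zᴴ * S⁻¹)).trace = (R⁻¹ * X * Zᴴ).trace := by
      have : S * R⁻¹ * X * (Zᴴ * S⁻¹) = S * (R⁻¹ * X * Zᴴ * S⁻¹) := by
        simp only [Matrix.mul_assoc]
      rw [this, Matrix.trace_mul_comm, Matrix.mul_assoc, hSi, Matrix.mul_one]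
    rw [a1, a2, Matrix.trace_sub, Matrix.trace_sub, Matrix.trace_sub, Matrix.trace_sub, a3]
    ring
  have e2 : (D'ᴴ * S * D').trace = S⁻¹.trace - R⁻¹.trace - R⁻¹.trace
      + (S * R⁻¹ * R⁻¹).trace := by
    rw [hD'h, Matrix.mul_assoc, Matrix.trace_mul_comm, hD']
    simp only [Matrix.mul_sub, Matrix.sub_mul, hSi', Matrix.one_mul, Matrix.trace_sub]
    have : (S * R⁻¹ * S⁻¹).trace = R⁻¹.trace := by
      rw [Matrix.mul_assoc, Matrix.trace_mul_comm, Matrix.mul_assoc, hSi, Matrix.mul_one]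
    rw [this]
    ring
  have e3 : (R⁻¹ * X * Zᴴ).trace.re = (Z * (R⁻¹ * X)ᴴ).trace.re := by
    have : R⁻¹ * X * Zᴴ = (Z * (R⁻¹ * X)ᴴ)ᴴ := by
      rw [Matrix.conjTranspose_mul, Matrix.conjTranspose_conjTranspose]
    rw [this, Matrix.trace_conjTranspose]
    simp
  have e4 : (X * (R⁻¹ * X)ᴴ).trace = R.trace - (v : ℂ) * R⁻¹.trace := by
    rw [Matrix.conjTranspose_mul, hRh, ← Matrix.mul_assoc, hXX, Matrix.sub_mul, Matrix.mul_assoc,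
      hRi', Matrix.mul_one, Matrix.smul_mul, Matrix.one_mul, Matrix.trace_sub, Matrix.trace_smul,
      smul_eq_mul]
  rw [e1] at hpos1
  rw [e2] at hpos2
  rw [Matrix.sub_mul, Matrix.trace_sub, e4]
  simp only [Matrix.trace_sub, Matrix.trace_smul, smul_eq_mul, Complex.add_re, Complex.sub_re,
    Complex.re_ofReal_mul, e3] at hpos1 hpos2 ⊢
  have := mul_nonneg hv hpos2
  nlinarith

theorem sum_norm_sq_eq_trace (X : Matrix (Fin n) (Fin m) ℂ) :
    ∑ i, ∑ j, ‖X i j‖ ^ 2 = (X * Xᴴ).trace.re := by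
  simp only [Matrix.trace, Matrix.diag, Matrix.mul_apply, Matrix.conjTranspose_apply,
    Complex.re_sum]
  refine Finset.sum_congr rfl fun i _ => Finset.sum_congr rfl fun j _ => ?_
  rw [Complex.star_def, Complex.mul_conj, Complex.normSq_eq_norm_sq, Complex.ofReal_re]

/-- The matrix `R⁻¹ X` is a contraction, since `(R⁻¹ X)(R⁻¹ X)* = 1 - v R⁻²`; taking the trace gives
`n`. -/
theorem sum_norm_sq_inv_mul_le {X : Matrix (Fin n) (Fin m) ℂ} {R : Matrix (Fin n) (Fin n) ℂ}
    {v : ℝ} (hv : 0 ≤ v) (hR : R.PosDef) (hRR : R * R = X * Xᴴ + (v : ℂ) • 1) :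
    ∑ i, ∑ j, ‖(R⁻¹ * X) i j‖ ^ 2 ≤ n := by
  have hRi : R⁻¹ * R = 1 := Matrix.nonsing_inv_mul _ ((Matrix.isUnit_iff_isUnit_det _).mp hR.isUnit)
  have hRi' : R * R⁻¹ = 1 := Matrix.mul_nonsing_inv _ ((Matrix.isUnit_iff_isUnit_det _).mp hR.isUnit)
  have hRh : (R⁻¹)ᴴ = R⁻¹ := hR.isHermitian.inv
  have hXX : X * Xᴴ = R * R - (v : ℂ) • 1 := by rw [hRR]; simp
  have hpos := (Complex.nonneg_iff.mp
    (Matrix.posSemidef_self_mul_conjTranspose R⁻¹).trace_nonneg).1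
  have e : R⁻¹ * X * (R⁻¹ * X)ᴴ = 1 - (v : ℂ) • (R⁻¹ * (R⁻¹)ᴴ) := by
    have : R⁻¹ * X * (R⁻¹ * X)ᴴ = R⁻¹ * (X * Xᴴ) * (R⁻¹)ᴴ := by
      rw [Matrix.conjTranspose_mul]
      simp only [Matrix.mul_assoc]
    rw [this, hXX, Matrix.mul_sub, Matrix.sub_mul, hRh, ← Matrix.mul_assoc, hRi, Matrix.one_mul,
      hRi']
    simp
  rw [sum_norm_sq_eq_trace, e, Matrix.trace_sub, Matrix.trace_smul, Matrix.trace_one]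
  simp only [smul_eq_mul, Complex.sub_re, Complex.re_ofReal_mul, Fintype.card_fin,
    Complex.natCast_re]
  have := mul_nonneg hv hpos
  linarith

/-- The linear statistic `∫ √(x² + u) dL(x)` of the empirical distribution `L` of the singular
values of `X / √n`. -/
def sqrtStat (u : ℝ) (X : Matrix (Fin n) (Fin m) ℂ) : ℝ :=
  (n : ℝ)⁻¹ * ∑ i, Real.sqrt
    ((Matrix.isHermitian_mul_conjTranspose_self X).eigenvalues i / n + u)

theorem integral_sqrt_singularESD [NeZero n] (X : Matrix (Fin n) (Fin m) ℂ) (u : ℝ) :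
    ∫ x, Real.sqrt (x ^ 2 + u) ∂(singularESD X : Measure ℝ) = sqrtStat u X := by
  rw [integral_singularESD X fun x => Real.sqrt (x ^ 2 + u), sqrtStat]
  congr 1
  refine Finset.sum_congr rfl fun i _ => ?_
  rw [mul_pow, inv_pow, Real.sq_sqrt (Nat.cast_nonneg n),
    Real.sq_sqrt (eigenvalues_mul_conjTranspose_self_nonneg X i), div_eq_inv_mul]

/-- `sqrtStat u` is convex and Lipschitz: it has subgradients of norm at most `1 / n`. -/
theorem exists_subgradient_sqrtStat [NeZero n] {u : ℝ} (hu : 0 < u)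
    (X : Matrix (Fin n) (Fin m) ℂ) :
    ∃ G : Matrix (Fin n) (Fin m) ℂ, (∑ i, ∑ j, ‖G i j‖ ^ 2 ≤ 1 / (n : ℝ) ^ 2) ∧
      ∀ Z, sqrtStat u X - sqrtStat u Z ≤ ∑ i, ∑ j, ((X i j - Z i j) * star (G i j)).re := by
  have hn : (0 : ℝ) < n := by exact_mod_cast NeZero.pos n
  have hv : (0 : ℝ) < n * u := by positivity
  have hstat (Z : Matrix (Fin n) (Fin m) ℂ) (S : Matrix (Fin n) (Fin n) ℂ)
      (hS : S.trace = ((∑ i, Real.sqrt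
        ((Matrix.isHermitian_mul_conjTranspose_self Z).eigenvalues i + n * u) : ℝ) : ℂ)) :
      sqrtStat u Z = (n : ℝ)⁻¹ * (Real.sqrt n)⁻¹ * S.trace.re := by
    rw [hS, Complex.ofReal_re, sqrtStat, mul_assoc]
    congr 1
    rw [Finset.mul_sum]
    refine Finset.sum_congr rfl fun i _ => ?_
    rw [← Real.sqrt_inv, ← Real.sqrt_mul (by positivity)]
    congr 1
    field_simp
  obtain ⟨R, hR, hRR, hRt⟩ := exists_posDef_sqrt_add X hv
  -- One factor `1/n` comes from averaging over eigenvalues, and `1/√n` from pulling the scaling of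
  -- the matrix out of the square root. Hence `v = n u`, and the squared norm of `a R⁻¹ X` is at
  -- most `a² n = 1/n²`.
  set a : ℝ := (n : ℝ)⁻¹ * (Real.sqrt n)⁻¹ with ha
  have ha0 : 0 ≤ a := by positivity
  have ha2 : a ^ 2 * n = 1 / (n : ℝ) ^ 2 := by
    rw [ha, mul_pow, inv_pow (Real.sqrt n), Real.sq_sqrt hn.le]
    field_simp
  refine ⟨(a : ℂ) • (R⁻¹ * X), ?_, fun Z => ?_⟩
  · rw [← ha2]
    calc ∑ i : Fin n, ∑ j : Fin m, ‖((a : ℂ) • (R⁻¹ * X)) i j‖ ^ 2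
        = a ^ 2 * ∑ i, ∑ j, ‖(R⁻¹ * X) i j‖ ^ 2 := by
          simp only [Finset.mul_sum, Matrix.smul_apply, smul_eq_mul, norm_mul, mul_pow,
            Complex.norm_real, Real.norm_eq_abs, sq_abs]
      _ ≤ a ^ 2 * n := by
          gcongr
          exact sum_norm_sq_inv_mul_le hv.le hR hRR
  · obtain ⟨S, hS, hSS, hSt⟩ := exists_posDef_sqrt_add Z hv
    rw [hstat X R hRt, hstat Z S hSt, ← mul_sub]
    refine (mul_le_mul_of_nonneg_left (re_trace_sub_le hv.le hR hS hRR hSS) ha0).trans_eq ?_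
    simp only [Matrix.trace, Matrix.diag, Complex.re_sum, Finset.mul_sum, Matrix.mul_apply (M := X - Z),
      Matrix.conjTranspose_apply]
    refine Finset.sum_congr rfl fun i _ => Finset.sum_congr rfl fun j _ => ?_
    rw [Matrix.smul_apply, smul_eq_mul, star_mul', Complex.star_def, Complex.conj_ofReal,
      mul_left_comm, Complex.re_ofReal_mul, Matrix.sub_apply]

end SqrtTrace

/-! ### Concentration of convex functions of matrices with independent blocks -/

section Subgradient

variable {ι : Type*} [Fintype ι]

/-- `h` has subgradients of squared norm at most `L` everywhere. -/
def HasBoundedSubgradients (h : (ι → ℂ) → ℝ) (L : ℝ) : Prop :=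
  ∀ y, ∃ G : ι → ℂ, ∑ p, ‖G p‖ ^ 2 ≤ L ∧
    ∀ z, h y - h z ≤ ∑ p, ((y p - z p) * star (G p)).re

theorem HasBoundedSubgradients.abs_sub_le {h : (ι → ℂ) → ℝ} {L : ℝ}
    (hh : HasBoundedSubgradients h L) (y z : ι → ℂ) :
    |h y - h z| ≤ Real.sqrt L * Real.sqrt (∑ p, ‖y p - z p‖ ^ 2) := by
  have key (y z : ι → ℂ) : h y - h z ≤ Real.sqrt L * Real.sqrt (∑ p, ‖y p - z p‖ ^ 2) := by
    obtain ⟨G, hG, hsub⟩ := hh y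
    calc h y - h z ≤ ∑ p, ((y p - z p) * star (G p)).re := hsub z
      _ ≤ ∑ p, ‖G p‖ * ‖y p - z p‖ := by
        refine Finset.sum_le_sum fun p _ => (Complex.re_le_norm _).trans ?_
        rw [norm_mul, norm_star, mul_comm]
      _ ≤ Real.sqrt (∑ p, ‖G p‖ ^ 2) * Real.sqrt (∑ p, ‖y p - z p‖ ^ 2) :=
        Real.sum_mul_le_sqrt_mul_sqrt _ _ _
      _ ≤ _ := by gcongr
  refine abs_le.mpr ⟨?_, key y z⟩
  have := key z y
  simp only [norm_sub_rev (z _)] at this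
  linarith

theorem HasBoundedSubgradients.continuous {h : (ι → ℂ) → ℝ} {L : ℝ}
    (hh : HasBoundedSubgradients h L) : Continuous h := by
  rw [continuous_iff_continuousAt]
  intro z
  rw [ContinuousAt, tendsto_iff_dist_tendsto_zero]
  have hc : Continuous fun y : ι → ℂ => Real.sqrt L * Real.sqrt (∑ p, ‖y p - z p‖ ^ 2) := by
    fun_prop
  have h0 := hc.tendsto z
  simp only [sub_self, norm_zero, ne_eq, OfNat.ofNat_ne_zero, not_false_eq_true, zero_pow,
    Finset.sum_const_zero, Real.sqrt_zero, mul_zero] at h0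
  exact squeeze_zero (fun _ => dist_nonneg) (fun y => hh.abs_sub_le y z) h0

/-- A Poincaré inequality for convex functions: if `h` has bounded subgradients, and the blocks
of `x` with respect to the partition of the index set into the fibres of `b` are independent, then
the variance of `h`, evaluated at a bounded transformation of the entries of `x`, is controlled by
the size of the blocks. -/
theorem HasBoundedSubgradients.variance_le {h : (ι → ℂ) → ℝ} {L : ℝ}
    (hh : HasBoundedSubgradients h L) {Ω : Type*} [MeasurableSpace Ω] {P : Measure Ω}
    [IsProbabilityMeasure P] {κ : Type*} [Fintype κ] [DecidableEq κ] (b : ι → κ)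
    {x : Ω → ι → ℂ} (hx : ∀ p, Measurable fun ω => x ω p)
    (hind : iIndepFun (fun k ω p => if b p = k then x ω p else 0) P)
    {d : ℝ} (hd0 : 0 ≤ d) (hd : ∀ k, ((Finset.univ.filter fun p => b p = k).card : ℝ) ≤ d)
    {t : ℂ → ℂ} (ht : Measurable t) {M : ℝ} (htM : ∀ a, ‖t a‖ ^ 2 ≤ M) :
    Var[fun ω => h fun p => t (x ω p); P] ≤ 4 * M * d * L := by
  have hM : 0 ≤ M := (sq_nonneg _).trans (htM 0)
  have hL : 0 ≤ L := by
    obtain ⟨G, hG, -⟩ := hh 0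
    exact (Finset.sum_nonneg fun _ _ => sq_nonneg _).trans hG
  -- Padding each block by zeros makes all blocks take values in one space, as the Efron–Stein
  -- inequality requires. The function `f` reads entry `p` only from the block `b p` that owns it.
  let Z (k : κ) (ω : Ω) (p : ι) : ℂ := if b p = k then x ω p else 0
  have hZ (k : κ) : Measurable (Z k) := measurable_pi_iff.mpr fun p => by
    by_cases hp : b p = k
    · simpa [Z, hp] using hx p
    · simp [Z, hp]
  let f (z : κ → ι → ℂ) : ℝ := h fun p => t (z (b p) p)
  have hf : Measurable f := by
    refine hh.continuous.measurable.comp (measurable_pi_iff.mpr fun p => ht.comp ?_)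
    exact (measurable_pi_apply p).comp (measurable_pi_apply (b p))
  have hfZ : (fun ω => h fun p => t (x ω p)) = f ∘ fun ω k => Z k ω := by
    funext ω
    simp [f, Z]
  have : ∀ k, IsProbabilityMeasure (P.map (Z k)) := fun k =>
    Measure.isProbabilityMeasure_map (hZ k).aemeasurable
  rw [hfZ, ← variance_map hf.aemeasurable (measurable_pi_iff.mpr hZ).aemeasurable,
    (iIndepFun_iff_map_fun_eq_pi_map fun k => (hZ k).aemeasurable).mp hind]
  refine variance_pi_le_of_sum_sq_le _ hf
    (C := |h 0| + Real.sqrt L * Real.sqrt (∑ _p : ι, M)) (fun z => ?_) fun z y => ?_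
  · have h1 := hh.abs_sub_le (fun p => t (z (b p) p)) 0
    have h2 : Real.sqrt L * Real.sqrt (∑ p, ‖t (z (b p) p) - (0 : ι → ℂ) p‖ ^ 2)
        ≤ Real.sqrt L * Real.sqrt (∑ _p : ι, M) := by
      gcongr with p
      simpa using htM (z (b p) p)
    have h3 := abs_sub_abs_le_abs_sub (f z) (h 0)
    simp only [f] at h3 ⊢
    linarith
  -- The subgradient `G` is taken at the unperturbed point `z`, so the same `G` serves every block
  -- `k`, and the partial sums of `‖G p‖²` over blocks add up to at most `L`. The factor `4 M`
  -- bounds the squared difference of two values of `t`.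
  · obtain ⟨G, hG, hsub⟩ := hh fun p => t (z (b p) p)
    have hblock (k : κ) : (max (f z - f (Function.update z k (y k))) 0) ^ 2
        ≤ 4 * M * d * ∑ p with b p = k, ‖G p‖ ^ 2 := by
      set a : ι → ℂ := fun p => t (z (b p) p) - t (Function.update z k (y k) (b p) p) with ha
      have h1 : f z - f (Function.update z k (y k))
          ≤ ∑ p with b p = k, ‖a p‖ * ‖G p‖ := by
        refine (hsub _).trans ?_
        rw [← Finset.sum_filter_add_sum_filter_not Finset.univ (fun p => b p = k)]
        have h0 : ∑ p with ¬ b p = k, ((t (z (b p) p)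
            - t (Function.update z k (y k) (b p) p)) * star (G p)).re = 0 := by
          refine Finset.sum_eq_zero fun p hp => ?_
          rw [Function.update_of_ne (Finset.mem_filter.mp hp).2]
          simp
        rw [h0, add_zero]
        refine Finset.sum_le_sum fun p _ => (Complex.re_le_norm _).trans ?_
        rw [norm_mul, norm_star]
      have hnn : 0 ≤ ∑ p with b p = k, ‖a p‖ * ‖G p‖ :=
        Finset.sum_nonneg fun p _ => by positivity
      have hbd (p : ι) : ‖a p‖ ^ 2 ≤ 4 * M := by
        have h2 := norm_sub_le (t (z (b p) p)) (t (Function.update z k (y k) (b p) p))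
        have h3 := htM (z (b p) p)
        have h4 := htM (Function.update z k (y k) (b p) p)
        have h5 : ‖a p‖ ^ 2 ≤ (‖t (z (b p) p)‖ + ‖t (Function.update z k (y k) (b p) p)‖) ^ 2 :=
          pow_le_pow_left₀ (norm_nonneg _) h2 2
        have h6 := sq_nonneg (‖t (z (b p) p)‖ - ‖t (Function.update z k (y k) (b p) p)‖)
        nlinarith
      calc (max (f z - f (Function.update z k (y k))) 0) ^ 2
          ≤ (∑ p with b p = k, ‖a p‖ * ‖G p‖) ^ 2 :=
            pow_le_pow_left₀ (le_max_right _ _) (max_le h1 hnn) 2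
        _ ≤ (∑ p with b p = k, ‖a p‖ ^ 2) * ∑ p with b p = k, ‖G p‖ ^ 2 :=
            Finset.sum_mul_sq_le_sq_mul_sq _ _ _
        _ ≤ (∑ p with b p = k, 4 * M) * ∑ p with b p = k, ‖G p‖ ^ 2 := by
            gcongr with p
            · exact hbd p
        _ ≤ 4 * M * d * ∑ p with b p = k, ‖G p‖ ^ 2 := by
            refine mul_le_mul_of_nonneg_right ?_ (Finset.sum_nonneg fun _ _ => sq_nonneg _)
            rw [Finset.sum_const, nsmul_eq_mul, mul_comm]
            exact mul_le_mul_of_nonneg_left (hd k) (by positivity)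
    calc ∑ k, (max (f z - f (Function.update z k (y k))) 0) ^ 2
        ≤ ∑ k, 4 * M * d * ∑ p with b p = k, ‖G p‖ ^ 2 := Finset.sum_le_sum fun k _ => hblock k
      _ = 4 * M * d * ∑ p, ‖G p‖ ^ 2 := by
          rw [← Finset.mul_sum, Finset.sum_fiberwise]
      _ ≤ 4 * M * d * L := by gcongr

end Subgradient

/-! ### Truncation of the entries and its effect on the linear statistic -/

section Truncation

variable {n m : ℕ} [NeZero n]

theorem hasBoundedSubgradients_sqrtStat {u : ℝ} (hu : 0 < u) :
    HasBoundedSubgradients (fun x : Fin n × Fin m → ℂ =>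
      sqrtStat u (Matrix.of fun i j => x (i, j))) (1 / (n : ℝ) ^ 2) := by
  intro y
  obtain ⟨G, hG, hsub⟩ := exists_subgradient_sqrtStat hu (Matrix.of fun i j => y (i, j))
  refine ⟨fun p => G p.1 p.2, ?_, fun z => ?_⟩
  · rwa [Fintype.sum_prod_type]
  · rw [Fintype.sum_prod_type]
    exact hsub (Matrix.of fun i j => z (i, j))

/-- Replace the entries with squared modulus larger than `M` by zero. -/
def truncEntry (M : ℝ) (a : ℂ) : ℂ := if M < ‖a‖ ^ 2 then 0 else a

theorem measurable_truncEntry (M : ℝ) : Measurable (truncEntry M) :=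
  Measurable.ite (measurableSet_lt measurable_const (by fun_prop)) measurable_const measurable_id

theorem norm_truncEntry_sq_le {M : ℝ} (hM : 0 ≤ M) (a : ℂ) : ‖truncEntry M a‖ ^ 2 ≤ M := by
  unfold truncEntry
  split_ifs with h
  · simpa using hM
  · exact not_lt.mp h

theorem measurable_sqrtStat {u : ℝ} (hu : 0 < u) {Ω : Type*} [MeasurableSpace Ω]
    {X : Ω → Matrix (Fin n) (Fin m) ℂ} (hX : ∀ i j, Measurable fun ω => X ω i j) :
    Measurable fun ω => sqrtStat u (X ω) :=
  (hasBoundedSubgradients_sqrtStat (n := n) (m := m) hu).continuous.measurable.comp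
    (g := fun x : Fin n × Fin m → ℂ => sqrtStat u (Matrix.of fun i j => x (i, j)))
    (f := fun ω p => X ω p.1 p.2) (measurable_pi_iff.mpr fun p => hX p.1 p.2)

/-- The Poincaré inequality applies with `L = 1/n²` and `b` sending an index to its part. The
absolute value is there because `d` may be negative when the index set is empty. -/
theorem variance_sqrtStat_le {u : ℝ} (hu : 0 < u) {Ω : Type*} [MeasurableSpace Ω] {P : Measure Ω}
    [IsProbabilityMeasure P] {X : Ω → Matrix (Fin n) (Fin m) ℂ}
    (hX : ∀ i j, Measurable fun ω => X ω i j) {d : ℝ} (hS : HasIndependentBlocks P X d)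
    {M : ℝ} (hM : 0 ≤ M) :
    Var[fun ω => sqrtStat u ((X ω).map (truncEntry M)); P] ≤ 4 * M * (|d| / (n : ℝ) ^ 2) := by
  obtain ⟨π, hd, hind⟩ := hS
  let b (p : Fin n × Fin m) : {B // B ∈ π.parts} :=
    ⟨π.part p, π.part_mem.mpr (Finset.mem_univ p)⟩
  have hb (p : Fin n × Fin m) (B : {B // B ∈ π.parts}) : b p = B ↔ p ∈ B.1 := by
    constructor
    · rintro rfl
      exact π.mem_part (Finset.mem_univ p)
    · exact fun hp => Subtype.ext (π.part_eq_of_mem B.2 hp)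
  have hind' : iIndepFun (fun B ω p => if b p = B then X ω p.1 p.2 else 0) P := by
    refine (hind.comp (fun B z p => if h : p ∈ B.1 then z ⟨p, h⟩ else 0) fun B => ?_).congr
      fun B => ae_of_all _ fun ω => ?_
    · refine measurable_pi_iff.mpr fun p => ?_
      by_cases hp : p ∈ B.1
      · simpa [hp] using measurable_pi_apply _
      · simp [hp]
    · funext p
      by_cases hp : p ∈ B.1
      · simp [hp, (hb p B).mpr hp]
      · simp [hp, mt (hb p B).mp hp]
  refine ((hasBoundedSubgradients_sqrtStat hu).variance_le b
    (x := fun ω p => X ω p.1 p.2) (fun p => hX p.1 p.2) hind' (abs_nonneg d) (fun B => ?_)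
    (measurable_truncEntry M) (norm_truncEntry_sq_le hM)).trans_eq ?_
  · refine le_trans ?_ ((hd B.1 B.2).trans (le_abs_self d))
    gcongr
    intro p hp
    exact (hb p B).mp (Finset.mem_filter.mp hp).2
  · ring

/-- The Lipschitz constant `1/n` is multiplied by the Euclidean norm of the discarded entries, whose
square is `n m` times the truncated second moment. -/
theorem abs_sqrtStat_sub_trunc_le {u : ℝ} (hu : 0 < u) (X : Matrix (Fin n) (Fin m) ℂ) (M : ℝ) :
    |sqrtStat u X - sqrtStat u (X.map (truncEntry M))|
      ≤ Real.sqrt ((m : ℝ) / n * truncatedSecondMoment X M) := by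
  have hn : (n : ℝ) ≠ 0 := by exact_mod_cast NeZero.ne n
  have h := (hasBoundedSubgradients_sqrtStat (n := n) (m := m) hu).abs_sub_le
    (fun p => X p.1 p.2) (fun p => truncEntry M (X p.1 p.2))
  refine h.trans_eq ?_
  rw [← Real.sqrt_mul (by positivity), Fintype.sum_prod_type, truncatedSecondMoment]
  congr 1
  have e (i : Fin n) (j : Fin m) : ‖X i j - truncEntry M (X i j)‖ ^ 2
      = if M < ‖X i j‖ ^ 2 then ‖X i j‖ ^ 2 else 0 := by
    unfold truncEntry
    split_ifs <;> simp
  simp only [e]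
  rcases Nat.eq_zero_or_pos m with rfl | hm
  · simp
  · have hm' : (m : ℝ) ≠ 0 := by exact_mod_cast hm.ne'
    field_simp

/-- The second moment of the empirical spectral distribution. -/
theorem integral_sq_singularESD_le (X : Matrix (Fin n) (Fin m) ℂ) {M : ℝ} (hM : 0 ≤ M) :
    ∫ x, x ^ 2 ∂(singularESD X : Measure ℝ)
      ≤ (m : ℝ) / n * (M + truncatedSecondMoment X M) := by
  have hn : (0 : ℝ) < n := by exact_mod_cast NeZero.pos n
  have e1 : ∫ x, x ^ 2 ∂(singularESD X : Measure ℝ)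
      = ((n : ℝ) ^ 2)⁻¹ * ∑ i, ∑ j, ‖X i j‖ ^ 2 := by
    rw [integral_singularESD X fun x => x ^ 2, sum_norm_sq_eq_trace,
      (Matrix.isHermitian_mul_conjTranspose_self X).trace_eq_sum_eigenvalues]
    have (i : Fin n) : ((Real.sqrt n)⁻¹ * Real.sqrt
        ((Matrix.isHermitian_mul_conjTranspose_self X).eigenvalues i)) ^ 2
        = (n : ℝ)⁻¹ * (Matrix.isHermitian_mul_conjTranspose_self X).eigenvalues i := by
      rw [mul_pow, inv_pow, Real.sq_sqrt hn.le,
        Real.sq_sqrt (eigenvalues_mul_conjTranspose_self_nonneg X i)]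
    simp only [this, ← Finset.mul_sum]
    simp only [Complex.re_sum, Complex.coe_algebraMap, Complex.ofReal_re]
    rw [← mul_assoc, ← mul_inv, ← sq]
  have e2 : ∑ i, ∑ j, ‖X i j‖ ^ 2
      ≤ ∑ i, ∑ j, (M + if M < ‖X i j‖ ^ 2 then ‖X i j‖ ^ 2 else 0) := by
    gcongr with i _ j _
    split_ifs with h
    · linarith
    · linarith
  rw [e1]
  refine (mul_le_mul_of_nonneg_left e2 (by positivity)).trans_eq ?_
  rw [truncatedSecondMoment]
  simp only [Finset.sum_add_distrib, Finset.sum_const, Finset.card_univ, Fintype.card_fin,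
    nsmul_eq_mul]
  rcases Nat.eq_zero_or_pos m with rfl | hm
  · simp
  · have hm' : (m : ℝ) ≠ 0 := by exact_mod_cast hm.ne'
    field_simp

end Truncation

/-! ### A convergence-determining family of functions -/

section Determining

open BoundedContinuousFunction

/-- The function `x ↦ √(x² + u)`, for `u ≥ 1`. -/
def hypot (u x : ℝ) : ℝ := Real.sqrt (x ^ 2 + max u 1)

theorem one_le_hypot (u x : ℝ) : 1 ≤ hypot u x := by
  rw [hypot, Real.one_le_sqrt]
  have := le_max_right u 1
  nlinarith [sq_nonneg x]

theorem hypot_sq (u x : ℝ) : hypot u x ^ 2 = x ^ 2 + max u 1 :=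
  Real.sq_sqrt (by have := le_max_right u 1; nlinarith [sq_nonneg x])

theorem continuous_hypot (u : ℝ) : Continuous (hypot u) := by
  unfold hypot
  fun_prop

theorem hypot_sub_hypot (u v x : ℝ) :
    hypot v x - hypot u x = (max v 1 - max u 1) / (hypot v x + hypot u x) := by
  have h1 := one_le_hypot u x
  have h2 := one_le_hypot v x
  rw [eq_div_iff (by positivity)]
  nlinarith [hypot_sq u x, hypot_sq v x]

theorem abs_hypot_sub_hypot_le (u v x : ℝ) :
    |hypot v x - hypot u x| ≤ |max v 1 - max u 1| := by
  have h1 := one_le_hypot u x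
  have h2 := one_le_hypot v x
  rw [hypot_sub_hypot, abs_div, abs_of_pos (by positivity : 0 < hypot v x + hypot u x)]
  exact div_le_self (abs_nonneg _) (by linarith)

/-- The bounded function `x ↦ √(x² + u) - √(x² + 1)`, for `u ≥ 1`. -/
def hypotDiff (u : ℝ) : ℝ →ᵇ ℝ :=
  BoundedContinuousFunction.ofNormedAddCommGroup (fun x => hypot u x - hypot 1 x)
    ((continuous_hypot u).sub (continuous_hypot 1)) |max u 1 - max 1 1|
    fun x => abs_hypot_sub_hypot_le 1 u x

/-- The bounded function `x ↦ 1 / √(x² + u)`, for `u ≥ 1`. -/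
def invHypot (u : ℝ) : ℝ →ᵇ ℝ :=
  BoundedContinuousFunction.ofNormedAddCommGroup (fun x => (hypot u x)⁻¹)
    ((continuous_hypot u).inv₀ fun x => (zero_lt_one.trans_le (one_le_hypot u x)).ne') 1
    fun x => by
      rw [Real.norm_of_nonneg (inv_nonneg.mpr (zero_le_one.trans (one_le_hypot u x)))]
      exact inv_le_one_of_one_le₀ (one_le_hypot u x)

theorem hasDerivAt_of_norm_sub_le_sq {E : Type*} [NormedAddCommGroup E] [NormedSpace ℝ E]
    {g : ℝ → E} {g' : E} {u C : ℝ}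
    (h : ∀ᶠ v in 𝓝 u, ‖g v - g u - (v - u) • g'‖ ≤ C * (v - u) ^ 2) : HasDerivAt g g' u := by
  rw [hasDerivAt_iff_isLittleO]
  have h1 : (fun v => g v - g u - (v - u) • g') =O[𝓝 u] fun v => (v - u) ^ 2 :=
    IsBigO.of_bound C (h.mono fun v hv => by rwa [Real.norm_of_nonneg (sq_nonneg _)])
  refine h1.trans_isLittleO ?_
  have h2 : Tendsto (fun v => v - u) (𝓝 u) (𝓝 0) := by
    simpa using (by fun_prop : Continuous fun v : ℝ => v - u).tendsto u
  exact (isLittleO_pow_id (𝕜 := ℝ) (one_lt_two)).comp_tendsto h2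

/-- The derivative is in the supremum norm: the Taylor remainder is explicit and at most `(v - u)²`
uniformly in `x`, because both square roots are at least one. -/
theorem hasDerivAt_hypotDiff {u : ℝ} (hu : 1 < u) :
    HasDerivAt hypotDiff ((2 : ℝ)⁻¹ • invHypot u) u := by
  refine hasDerivAt_of_norm_sub_le_sq (C := 1) ?_
  filter_upwards [lt_mem_nhds hu] with v hv
  rw [one_mul, BoundedContinuousFunction.norm_le (sq_nonneg _)]
  intro x
  change |(hypot v x - hypot 1 x) - (hypot u x - hypot 1 x)
    - (v - u) * (2⁻¹ * (hypot u x)⁻¹)| ≤ (v - u) ^ 2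
  have ha := one_le_hypot u x
  have hb := one_le_hypot v x
  have hab := hypot_sub_hypot u v x
  rw [max_eq_left hu.le, max_eq_left hv.le] at hab
  set a := hypot u x
  set b := hypot v x
  have e : (b - hypot 1 x) - (a - hypot 1 x) - (v - u) * (2⁻¹ * a⁻¹)
      = -((v - u) ^ 2 / (2 * a * (b + a) ^ 2)) := by
    have h1 : (v - u) = (b - a) * (b + a) := by rw [hab]; field_simp
    rw [h1]
    field_simp
    ring
  rw [e, abs_neg, abs_of_nonneg (by positivity)]
  refine div_le_self (sq_nonneg _) ?_
  nlinarith [one_le_pow₀ (by linarith : 1 ≤ b + a) (n := 2)]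

theorem hasDerivAt_invHypot {u : ℝ} (hu : 1 < u) :
    HasDerivAt invHypot ((-2 : ℝ)⁻¹ • invHypot u ^ 3) u := by
  refine hasDerivAt_of_norm_sub_le_sq (C := 1) ?_
  filter_upwards [lt_mem_nhds hu] with v hv
  rw [one_mul, BoundedContinuousFunction.norm_le (sq_nonneg _)]
  intro x
  change |(hypot v x)⁻¹ - (hypot u x)⁻¹ - (v - u) * ((-2)⁻¹ * (hypot u x)⁻¹ ^ 3)| ≤ (v - u) ^ 2
  have ha := one_le_hypot u x
  have hb := one_le_hypot v x
  have hab := hypot_sub_hypot u v x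
  rw [max_eq_left hu.le, max_eq_left hv.le] at hab
  set a := hypot u x
  set b := hypot v x
  have e : b⁻¹ - a⁻¹ - (v - u) * ((-2)⁻¹ * a⁻¹ ^ 3)
      = (v - u) ^ 2 * ((b + 2 * a) / (2 * a ^ 3 * b * (b + a) ^ 2)) := by
    have h1 : (v - u) = (b - a) * (b + a) := by rw [hab]; field_simp
    rw [h1]
    field_simp
    ring
  rw [e, abs_of_nonneg (by positivity)]
  refine mul_le_of_le_one_right (sq_nonneg _) ?_
  rw [div_le_one (by positivity)]
  have h3 : 1 ≤ a ^ 3 * b := one_le_mul_of_one_le_of_one_le (one_le_pow₀ ha) hb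
  have h4 : 2 * a ^ 3 * b * (b + a) ^ 2 = 2 * (b + a) ^ 2 * (a ^ 3 * b) := by ring
  rw [h4]
  refine le_trans ?_ (le_mul_of_one_le_right (by positivity) h3)
  nlinarith

theorem HasDerivAt.mem_of_eventually_mem {E : Type*} [NormedAddCommGroup E] [NormedSpace ℝ E]
    {V : Submodule ℝ E} (hV : IsClosed (V : Set E)) {g : ℝ → E} {g' : E} {u : ℝ}
    (hg : HasDerivAt g g' u) (h : ∀ᶠ v in 𝓝 u, g v ∈ V) : g' ∈ V := by
  refine hV.mem_of_tendsto (hasDerivAt_iff_tendsto_slope.mp hg) ?_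
  have hu := h.self_of_nhds
  filter_upwards [nhdsWithin_le_nhds h] with v hv
  exact V.smul_mem _ (V.sub_mem hv hu)

variable {V : Submodule ℝ (ℝ →ᵇ ℝ)}

/-- A closed subspace containing a differentiable curve contains its derivatives. Density of the
rationals gives the whole curve `hypotDiff u`; its derivative is a multiple of `invHypot u`, and
each further differentiation in `u` raises the exponent by two. -/
theorem invHypot_pow_mem (hV : IsClosed (V : Set (ℝ →ᵇ ℝ)))
    (h : ∀ q : ℚ, (1 : ℝ) < q → hypotDiff q ∈ V) (k : ℕ) :
    ∀ u : ℝ, 1 < u → invHypot u ^ (2 * k + 1) ∈ V := by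
  have hdiff (u : ℝ) (hu : 1 < u) : hypotDiff u ∈ V := by
    have hcl : u ∈ closure (Set.Ioi (1 : ℝ) ∩ Set.range ((↑) : ℚ → ℝ)) :=
      Rat.denseRange_cast.open_subset_closure_inter isOpen_Ioi hu
    obtain ⟨s, hs, hsu⟩ := mem_closure_iff_seq_limit.mp hcl
    refine hV.mem_of_tendsto ((hasDerivAt_hypotDiff hu).continuousAt.tendsto.comp hsu)
      (Eventually.of_forall fun j => ?_)
    obtain ⟨hj, q, hq⟩ := hs j
    simp only [Function.comp_apply, ← hq]
    exact h q (by rw [hq]; exact hj)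
  induction k with
  | zero =>
    intro u hu
    have := HasDerivAt.mem_of_eventually_mem hV (hasDerivAt_hypotDiff hu)
      ((lt_mem_nhds hu).mono fun v hv => hdiff v hv)
    rw [mul_zero, zero_add, pow_one]
    simpa using V.smul_mem 2 this
  | succ k ih =>
    intro u hu
    have hd := (hasDerivAt_invHypot hu).pow (2 * k + 1)
    have := HasDerivAt.mem_of_eventually_mem hV hd ((lt_mem_nhds hu).mono fun v hv => ih v hv)
    have e : ((2 * k + 1 : ℕ) : ℝ →ᵇ ℝ) * invHypot u ^ (2 * k + 1 - 1)
        * ((-2 : ℝ)⁻¹ • invHypot u ^ 3)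
        = (((2 * k + 1 : ℕ) : ℝ) * (-2)⁻¹) • invHypot u ^ (2 * (k + 1) + 1) := by
      rw [mul_smul_comm, mul_comm (((2 * k + 1 : ℕ) : ℝ)), mul_smul, Nat.cast_smul_eq_nsmul,
        nsmul_eq_mul, mul_assoc, ← pow_add]
      congr 3
    rw [e] at this
    refine (V.smul_mem_iff ?_).mp this
    positivity

/-- With `r = 1/√(x² + 2)`, the space `V` contains `p(r²) r` for every polynomial `p`. On the
half-line `r²` determines `x`, so `f` can be written as `g(r²) r` and Weierstrass approximation
applied to `g` on `[0, 1]`. -/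
theorem exists_mem_near_of_eq_zero (hV : IsClosed (V : Set (ℝ →ᵇ ℝ)))
    (h : ∀ q : ℚ, (1 : ℝ) < q → hypotDiff q ∈ V) {f : ℝ → ℝ} (hf : Continuous f) {K : ℝ}
    (hK : 0 ≤ K) (hfK : ∀ x, K ≤ x → f x = 0) {ε : ℝ} (hε : 0 < ε) :
    ∃ v ∈ V, ∀ x, 0 ≤ x → |f x - v x| ≤ ε := by
  set r := invHypot 2 with hr
  set δ : ℝ := (K ^ 2 + 2)⁻¹ with hδ
  have hδ0 : 0 < δ := by positivity
  -- This inverts `y = 1/(x² + 2)` and divides by `r = √y`. The floor `δ` is the value of `y` at `x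
  -- = K`; below it `f` vanishes, so the floor removes the singularity at `y = 0` and changes
  -- nothing else.
  let g (y : ℝ) : ℝ := f (Real.sqrt ((max y δ)⁻¹ - 2)) * Real.sqrt (max y δ)⁻¹
  have hmax (y : ℝ) : max y δ ≠ 0 := (hδ0.trans_le (le_max_right _ _)).ne'
  have hg : Continuous g := by
    have : Continuous fun y => (max y δ)⁻¹ := (by fun_prop : Continuous fun y => max y δ).inv₀ hmax
    exact (hf.comp (by fun_prop)).mul (by fun_prop)
  obtain ⟨p, hp⟩ := exists_polynomial_near_of_continuousOn 0 1 g hg.continuousOn ε hε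
  refine ⟨Polynomial.aeval (r ^ 2) p * r, ?_, fun x hx => ?_⟩
  · rw [Polynomial.aeval_eq_sum_range, Finset.sum_mul]
    refine V.sum_mem fun k _ => ?_
    rw [smul_mul_assoc, ← pow_mul, ← pow_succ]
    exact V.smul_mem _ (invHypot_pow_mem hV h k 2 one_lt_two)
  · have hrx : r x = (hypot 2 x)⁻¹ := rfl
    have hh1 := one_le_hypot 2 x
    have hh2 := hypot_sq 2 x
    rw [max_eq_left one_le_two] at hh2
    have hr0 : 0 < r x := by rw [hrx]; positivity
    have hr1 : r x ≤ 1 := by rw [hrx]; exact inv_le_one_of_one_le₀ hh1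
    have hr2 : r x ^ 2 = (x ^ 2 + 2)⁻¹ := by rw [hrx, inv_pow, hh2]
    have hval : (Polynomial.aeval (r ^ 2) p * r) x = p.eval (r x ^ 2) * r x := by
      rw [BoundedContinuousFunction.mul_apply, Polynomial.aeval_eq_sum_range,
        Polynomial.eval_eq_sum_range, BoundedContinuousFunction.sum_apply]
      simp
    have hfx : f x = g (r x ^ 2) * r x := by
      simp only [g]
      rcases le_total δ (r x ^ 2) with hle | hle
      · rw [max_eq_left hle, hr2, inv_inv, add_sub_cancel_right, Real.sqrt_sq hx, ← hh2,
          Real.sqrt_sq (by positivity), hrx, mul_assoc, mul_inv_cancel₀ (by positivity), mul_one]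
      · have hKx : K ≤ x := by
          rw [hr2, hδ, inv_le_inv₀ (by positivity) (by positivity)] at hle
          exact (sq_le_sq₀ hK hx).mp (by linarith)
        rw [max_eq_right hle, hδ, inv_inv, add_sub_cancel_right, Real.sqrt_sq hK, hfK x hKx,
          hfK K le_rfl, zero_mul, zero_mul]
    rw [hval, hfx, ← sub_mul, abs_mul, abs_of_pos hr0, abs_sub_comm]
    have := hp (r x ^ 2) ⟨by positivity, pow_le_one₀ hr0.le hr1⟩
    nlinarith [abs_nonneg (Polynomial.eval (r x ^ 2) p - g (r x ^ 2))]

/-- The bounded continuous functions along which a family of probability measures converges. -/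
def convergenceSubmodule {γ : Type*} (l : Filter γ) (ν : γ → ProbabilityMeasure ℝ)
    (μ : ProbabilityMeasure ℝ) : Submodule ℝ (ℝ →ᵇ ℝ) where
  carrier := {f | Tendsto (fun j => ∫ x, f x ∂(ν j : Measure ℝ)) l (𝓝 (∫ x, f x ∂(μ : Measure ℝ)))}
  zero_mem' := by simpa using tendsto_const_nhds
  add_mem' {f g} hf hg := by
    have e (ρ : ProbabilityMeasure ℝ) : ∫ x, (f + g) x ∂(ρ : Measure ℝ)
        = ∫ x, f x ∂(ρ : Measure ℝ) + ∫ x, g x ∂(ρ : Measure ℝ) :=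
      integral_add (f.integrable _) (g.integrable _)
    simp only [Set.mem_ofPred_eq, e] at hf hg ⊢
    exact hf.add hg
  smul_mem' c f hf := by
    have e (ρ : ProbabilityMeasure ℝ) : ∫ x, (c • f) x ∂(ρ : Measure ℝ)
        = c * ∫ x, f x ∂(ρ : Measure ℝ) := integral_const_mul c _
    simp only [Set.mem_ofPred_eq, e] at hf ⊢
    exact hf.const_mul c

theorem abs_integral_sub_le_of_ae {ρ : ProbabilityMeasure ℝ} (f g : ℝ →ᵇ ℝ) {ε : ℝ}
    (h : ∀ᵐ x ∂(ρ : Measure ℝ), |f x - g x| ≤ ε) :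
    |∫ x, f x ∂(ρ : Measure ℝ) - ∫ x, g x ∂(ρ : Measure ℝ)| ≤ ε := by
  rw [← integral_sub (f.integrable _) (g.integrable _)]
  simpa using norm_integral_le_of_norm_le_const (μ := (ρ : Measure ℝ))
    (f := fun x => f x - g x) (C := ε) h

theorem mem_convergenceSubmodule_of_near {γ : Type*} {l : Filter γ}
    {ν : γ → ProbabilityMeasure ℝ} {μ : ProbabilityMeasure ℝ} {f : ℝ →ᵇ ℝ}
    (h : ∀ ε : ℝ, 0 < ε → ∃ g ∈ convergenceSubmodule l ν μ,
      (∀ j, ∀ᵐ x ∂(ν j : Measure ℝ), |f x - g x| ≤ ε) ∧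
        ∀ᵐ x ∂(μ : Measure ℝ), |f x - g x| ≤ ε) :
    f ∈ convergenceSubmodule l ν μ := by
  change Tendsto _ _ _
  rw [Metric.tendsto_nhds]
  intro ε hε
  obtain ⟨g, hg, hν, hμ⟩ := h (ε / 4) (by positivity)
  filter_upwards [Metric.tendsto_nhds.mp hg (ε / 4) (by positivity)] with j hj
  have h1 := abs_integral_sub_le_of_ae f g (hν j)
  have h2 := abs_integral_sub_le_of_ae f g hμ
  rw [Real.dist_eq] at hj ⊢
  rw [abs_le] at h1 h2
  rw [abs_lt] at hj ⊢
  constructor <;> linarith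

theorem isClosed_convergenceSubmodule {γ : Type*} (l : Filter γ)
    (ν : γ → ProbabilityMeasure ℝ) (μ : ProbabilityMeasure ℝ) :
    IsClosed (convergenceSubmodule l ν μ : Set (ℝ →ᵇ ℝ)) := by
  refine isClosed_of_closure_subset fun f hf => mem_convergenceSubmodule_of_near fun ε hε => ?_
  obtain ⟨g, hg, hfg⟩ := Metric.mem_closure_iff.mp hf ε hε
  have (x : ℝ) : |f x - g x| ≤ ε :=
    (Real.dist_eq _ _).symm.le.trans ((BoundedContinuousFunction.dist_coe_le_dist x).trans hfg.le)
  exact ⟨g, hg, fun _ => ae_of_all _ this, ae_of_all _ this⟩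

/-- A continuous cutoff function, equal to one on `[-k, k]`. -/
def cutoff (k : ℕ) : ℝ →ᵇ ℝ :=
  BoundedContinuousFunction.ofNormedAddCommGroup (fun x => max 0 (min 1 ((k : ℝ) + 1 - |x|)))
    (by fun_prop) 1 fun x => by
      rw [Real.norm_of_nonneg (le_max_left _ _)]
      exact max_le zero_le_one (min_le_left _ _)

theorem cutoff_apply (k : ℕ) (x : ℝ) : cutoff k x = max 0 (min 1 ((k : ℝ) + 1 - |x|)) := rfl

theorem cutoff_nonneg (k : ℕ) (x : ℝ) : 0 ≤ cutoff k x := le_max_left _ _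

theorem cutoff_le_one (k : ℕ) (x : ℝ) : cutoff k x ≤ 1 := max_le zero_le_one (min_le_left _ _)

theorem tendsto_integral_cutoff (μ : ProbabilityMeasure ℝ) :
    Tendsto (fun k => ∫ x, cutoff k x ∂(μ : Measure ℝ)) atTop (𝓝 1) := by
  have := tendsto_integral_of_dominated_convergence (μ := (μ : Measure ℝ))
    (F := fun k x => cutoff k x) (f := fun _ => (1 : ℝ)) (fun _ => 1)
    (fun k => (cutoff k).continuous.aestronglyMeasurable) (integrable_const _)
    (fun k => ae_of_all _ fun x => by
      rw [Real.norm_of_nonneg (cutoff_nonneg k x)]; exact cutoff_le_one k x)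
    (ae_of_all _ fun x => by
      obtain ⟨K, hK⟩ := exists_nat_ge |x|
      refine tendsto_const_nhds.congr' ?_
      filter_upwards [eventually_ge_atTop K] with k hk
      have : (K : ℝ) ≤ k := by exact_mod_cast hk
      rw [cutoff_apply, min_eq_left (by linarith), max_eq_right zero_le_one])
  simpa using this

/-- The functions `x ↦ √(x² + q) - √(x² + 1)` with rational `q > 1` determine weak convergence of
probability measures on the half-line towards a probability measure. -/
theorem tendsto_of_tendsto_integral_hypotDiff {γ : Type*} {l : Filter γ}
    {ν : γ → ProbabilityMeasure ℝ} {μ : ProbabilityMeasure ℝ}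
    (hν : ∀ j, ∀ᵐ x ∂(ν j : Measure ℝ), 0 ≤ x) (hμ : ∀ᵐ x ∂(μ : Measure ℝ), 0 ≤ x)
    (h : ∀ q : ℚ, (1 : ℝ) < q → Tendsto (fun j => ∫ x, hypotDiff q x ∂(ν j : Measure ℝ)) l
      (𝓝 (∫ x, hypotDiff q x ∂(μ : Measure ℝ)))) :
    Tendsto ν l (𝓝 μ) := by
  have hcpt (f : ℝ →ᵇ ℝ) (k : ℕ) : Tendsto (fun j => ∫ x, (f * cutoff k) x ∂(ν j : Measure ℝ)) l
      (𝓝 (∫ x, (f * cutoff k) x ∂(μ : Measure ℝ))) := by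
    refine mem_convergenceSubmodule_of_near (l := l) (ν := ν) (μ := μ) fun ε hε => ?_
    obtain ⟨v, hv, hfv⟩ := exists_mem_near_of_eq_zero (isClosed_convergenceSubmodule l ν μ) h
      (f * cutoff k).continuous (K := k + 1) (by positivity) (fun x hx => by
        rw [BoundedContinuousFunction.mul_apply, cutoff_apply, max_eq_left, mul_zero]
        exact (min_le_right _ _).trans (by linarith [le_abs_self x])) hε
    exact ⟨v, hv, fun j => (hν j).mono fun x hx => hfv x hx, hμ.mono fun x hx => hfv x hx⟩
  rw [ProbabilityMeasure.tendsto_iff_forall_integral_tendsto]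
  intro f
  have hbd (ρ : ProbabilityMeasure ℝ) (k : ℕ) : |∫ x, f x ∂(ρ : Measure ℝ)
      - ∫ x, (f * cutoff k) x ∂(ρ : Measure ℝ)|
      ≤ ‖f‖ * (1 - ∫ x, cutoff k x ∂(ρ : Measure ℝ)) := by
    have e : 1 - ∫ x, cutoff k x ∂(ρ : Measure ℝ) = ∫ x, (1 - cutoff k x) ∂(ρ : Measure ℝ) := by
      rw [integral_sub (integrable_const _) ((cutoff k).integrable _)]
      simp
    rw [← integral_sub (f.integrable _) ((f * cutoff k).integrable _), e, ← integral_const_mul]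
    have hi : Integrable (fun x => ‖f‖ * (1 - cutoff k x)) (ρ : Measure ℝ) :=
      ((integrable_const _).sub ((cutoff k).integrable _)).const_mul _
    rw [← Real.norm_eq_abs]
    refine norm_integral_le_of_norm_le hi (ae_of_all _ fun x => ?_)
    have : f x - (f * cutoff k) x = f x * (1 - cutoff k x) := by
      rw [BoundedContinuousFunction.mul_apply]; ring
    rw [this, norm_mul, Real.norm_of_nonneg (sub_nonneg.mpr (cutoff_le_one k x))]
    exact mul_le_mul_of_nonneg_right (f.norm_coe_le_norm x) (sub_nonneg.mpr (cutoff_le_one k x))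
  rw [Metric.tendsto_nhds]
  intro ε hε
  set η := ε / (4 * (‖f‖ + 1)) with hη
  have hf0 := norm_nonneg f
  have hη0 : 0 < η := by positivity
  have hηε : ‖f‖ * η ≤ ε / 4 := by
    rw [hη, mul_div_assoc', div_le_div_iff₀ (by positivity) (by positivity)]
    nlinarith
  obtain ⟨k, hk⟩ := ((tendsto_integral_cutoff μ).eventually
    (lt_mem_nhds (by linarith : 1 - η / 2 < 1))).exists
  -- No tightness of `ν` is assumed: the cutoff is itself a compactly supported test function and
  -- `μ` is a probability measure, so convergence of its integral prevents mass from escaping.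
  have hone : Tendsto (fun j => ∫ x, cutoff k x ∂(ν j : Measure ℝ)) l
      (𝓝 (∫ x, cutoff k x ∂(μ : Measure ℝ))) := by simpa using hcpt 1 k
  filter_upwards [Metric.tendsto_nhds.mp (hcpt f k) (ε / 4) (by positivity),
    hone.eventually (lt_mem_nhds (by linarith : 1 - η < ∫ x, cutoff k x ∂(μ : Measure ℝ)))]
    with j h1 h2
  have h3 := hbd (ν j) k
  have h4 := hbd μ k
  have h5 : ‖f‖ * (1 - ∫ x, cutoff k x ∂(ν j : Measure ℝ)) ≤ ‖f‖ * η := by gcongr; linarith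
  have h6 : ‖f‖ * (1 - ∫ x, cutoff k x ∂(μ : Measure ℝ)) ≤ ‖f‖ * η := by gcongr; linarith
  rw [Real.dist_eq] at h1 ⊢
  rw [abs_le] at h3 h4
  rw [abs_lt] at h1 ⊢
  constructor <;> linarith

end Determining

/-! ### Linear statistics of one random matrix -/

section OneMatrix

theorem integral_meanMeasure {Ω : Type*} [MeasurableSpace Ω] (P : Measure Ω)
    [IsProbabilityMeasure P] (μ : Ω → ProbabilityMeasure ℝ) (hμ : Measurable μ)
    (f : BoundedContinuousFunction ℝ ℝ) :
    ∫ x, f x ∂(meanMeasure P μ hμ : Measure ℝ) = ∫ ω, ∫ x, f x ∂(μ ω : Measure ℝ) ∂P := by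
  let η : Kernel Ω ℝ := ⟨fun ω => (μ ω : Measure ℝ), measurable_subtype_coe.comp hμ⟩
  have e : (meanMeasure P μ hμ : Measure ℝ) = (η ∘ₖ Kernel.const Unit P) () := by
    rw [Kernel.comp_apply, Kernel.const_apply]
    rfl
  have hi : Integrable f ((η ∘ₖ Kernel.const Unit P) ()) := by
    rw [← e]
    exact f.integrable _
  rw [e, Kernel.integral_comp hi, Kernel.const_apply]
  rfl

variable {n m : ℕ}

theorem measurable_truncatedSecondMoment {Ω : Type*} [MeasurableSpace Ω]
    {X : Ω → Matrix (Fin n) (Fin m) ℂ} (hX : ∀ i j, Measurable fun ω => X ω i j) (M : ℝ) :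
    Measurable fun ω => truncatedSecondMoment (X ω) M := by
  unfold truncatedSecondMoment
  refine Measurable.const_mul ?_ _
  refine Finset.measurable_sum _ fun i _ => Finset.measurable_sum _ fun j _ => ?_
  have h : Measurable fun ω => ‖X ω i j‖ ^ 2 := (hX i j).norm.pow_const 2
  exact Measurable.ite (measurableSet_lt measurable_const h) h measurable_const

variable [NeZero n]

theorem integrable_singularESD (X : Matrix (Fin n) (Fin m) ℂ) (f : ℝ → ℝ) :
    Integrable f (singularESD X : Measure ℝ) := by
  refine Integrable.smul_measure ?_ (ENNReal.inv_ne_top.mpr (by exact_mod_cast NeZero.ne n))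
  exact integrable_finsetSum_measure.mpr fun i _ => integrable_dirac (by simp)

/-- The functions `hypotDiff u` are even, so they can determine a limit only among measures on the
half-line. -/
theorem ae_nonneg_singularESD (X : Matrix (Fin n) (Fin m) ℂ) :
    ∀ᵐ x ∂(singularESD X : Measure ℝ), 0 ≤ x := by
  have h := integral_singularESD X fun x => max (-x) 0
  have h0 : ∀ i, max (-((Real.sqrt n)⁻¹ * Real.sqrt
      ((Matrix.isHermitian_mul_conjTranspose_self X).eigenvalues i))) 0 = 0 := fun i =>
    max_eq_right (neg_nonpos.mpr (by positivity))
  simp only [h0, Finset.sum_const_zero, mul_zero] at h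
  rw [integral_eq_zero_iff_of_nonneg (f := fun x : ℝ => max (-x) 0) (fun _ => le_max_right _ _)
    (integrable_singularESD X _)] at h
  filter_upwards [h] with x hx
  have : -x ≤ 0 := (le_max_left (-x) 0).trans hx.le
  linarith

theorem integral_hypotDiff_singularESD (X : Matrix (Fin n) (Fin m) ℂ) {u : ℝ} (hu : 1 ≤ u) :
    ∫ x, hypotDiff u x ∂(singularESD X : Measure ℝ) = sqrtStat u X - sqrtStat 1 X := by
  rw [← integral_sqrt_singularESD, ← integral_sqrt_singularESD,
    ← integral_sub (integrable_singularESD X _) (integrable_singularESD X _)]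
  refine integral_congr_ae (ae_of_all _ fun x => ?_)
  change hypot u x - hypot 1 x = _
  simp only [hypot, max_eq_left hu, max_self]

theorem measure_norm_gt_singularESD_le (X : Matrix (Fin n) (Fin m) ℂ) {M : ℝ} (hM : 0 ≤ M)
    {r : ℝ} (hr : 0 < r) : (singularESD X : Measure ℝ) {x | r < ‖x‖}
      ≤ ENNReal.ofReal ((m : ℝ) / n * (M + truncatedSecondMoment X M) / r ^ 2) := by
  have h1 := mul_meas_ge_le_integral_of_nonneg (μ := (singularESD X : Measure ℝ))
    (f := fun x => x ^ 2) (ae_of_all _ fun _ => sq_nonneg _) (integrable_singularESD X _) (r ^ 2)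
  have h2 : (singularESD X : Measure ℝ) {x | r < ‖x‖}
      ≤ (singularESD X : Measure ℝ) {x | r ^ 2 ≤ x ^ 2} := by
    refine measure_mono fun x hx => ?_
    have hx' : r < |x| := hx
    have hx2 : r ^ 2 ≤ x ^ 2 := sq_le_sq.mpr (by rw [abs_of_pos hr]; exact hx'.le)
    exact hx2
  refine h2.trans ?_
  rw [← ofReal_measureReal]
  refine ENNReal.ofReal_le_ofReal ?_
  rw [le_div_iff₀ (by positivity), mul_comm]
  exact h1.trans (integral_sq_singularESD_le X hM)

theorem abs_sqrtStat_sub_le (X : Matrix (Fin n) (Fin m) ℂ) {u : ℝ} (hu : 1 ≤ u) :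
    |sqrtStat u X - sqrtStat 1 X| ≤ u - 1 := by
  rw [← integral_hypotDiff_singularESD X hu]
  have : ∀ x, ‖hypotDiff u x‖ ≤ u - 1 := fun x => by
    refine (abs_hypot_sub_hypot_le 1 u x).trans_eq ?_
    rw [max_eq_left hu, max_self, abs_of_nonneg (by linarith)]
  simpa using norm_integral_le_of_norm_le_const (μ := (singularESD X : Measure ℝ))
    (f := fun x => hypotDiff u x) (C := u - 1) (ae_of_all _ this)

theorem memLp_sqrtStat_trunc {Ω : Type*} [MeasurableSpace Ω] {P : Measure Ω}
    [IsProbabilityMeasure P] {X : Ω → Matrix (Fin n) (Fin m) ℂ}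
    (hX : ∀ i j, Measurable fun ω => X ω i j) {u : ℝ} (hu : 0 < u) {M : ℝ} (hM : 0 ≤ M) :
    MemLp (fun ω => sqrtStat u ((X ω).map (truncEntry M))) 2 P := by
  have hmeas : Measurable fun ω => sqrtStat u ((X ω).map (truncEntry M)) :=
    measurable_sqrtStat hu fun i j => (measurable_truncEntry M).comp (hX i j)
  set f : (Fin n × Fin m → ℂ) → ℝ := fun x => sqrtStat u (Matrix.of fun i j => x (i, j)) with hf
  refine MemLp.of_bound hmeas.aestronglyMeasurable (|f 0| + Real.sqrt (1 / (n : ℝ) ^ 2)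
    * Real.sqrt (∑ _p : Fin n × Fin m, M)) (ae_of_all _ fun ω => ?_)
  have h1 : |f (fun p => truncEntry M (X ω p.1 p.2)) - f 0| ≤ _ :=
    (hasBoundedSubgradients_sqrtStat (n := n) (m := m) hu).abs_sub_le
      (fun p => truncEntry M (X ω p.1 p.2)) 0
  have h2 : Real.sqrt (1 / (n : ℝ) ^ 2) * Real.sqrt
      (∑ p : Fin n × Fin m, ‖truncEntry M (X ω p.1 p.2) - (0 : Fin n × Fin m → ℂ) p‖ ^ 2)
      ≤ Real.sqrt (1 / (n : ℝ) ^ 2) * Real.sqrt (∑ _p : Fin n × Fin m, M) := by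
    gcongr with p
    simpa using norm_truncEntry_sq_le hM _
  have h3 := abs_sub_abs_le_abs_sub (f fun p => truncEntry M (X ω p.1 p.2)) (f 0)
  have h4 : f (fun p => truncEntry M (X ω p.1 p.2)) = sqrtStat u ((X ω).map (truncEntry M)) := rfl
  rw [h4] at h1 h3
  rw [Real.norm_eq_abs]
  linarith

/-- A deviation inequality for the linear statistic of `hypotDiff u`. -/
theorem measure_deviation_le {Ω : Type*} [MeasurableSpace Ω] {P : Measure Ω}
    [IsProbabilityMeasure P] {X : Ω → Matrix (Fin n) (Fin m) ℂ}
    (hX : ∀ i j, Measurable fun ω => X ω i j) {d : ℝ} (hS : HasIndependentBlocks P X d)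
    {u : ℝ} (hu : 1 ≤ u) {M : ℝ} (hM : 0 ≤ M) {τ η : ℝ} (hη : 0 < η)
    (hsmall : 4 * Real.sqrt ((m : ℝ) / n * τ)
      + 2 * (u - 1) * P.real {ω | τ < truncatedSecondMoment (X ω) M} ≤ η / 4) :
    P {ω | η < |∫ x, hypotDiff u x ∂(singularESD (X ω) : Measure ℝ)
        - ∫ ω', ∫ x, hypotDiff u x ∂(singularESD (X ω') : Measure ℝ) ∂P|}
      ≤ P {ω | τ < truncatedSecondMoment (X ω) M}
        + 2 * ENNReal.ofReal (4 * M * (|d| / (n : ℝ) ^ 2) / (η / 4) ^ 2) := by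
  simp only [integral_hypotDiff_singularESD _ hu]
  have hu0 : 0 < u := by linarith
  set Q := {ω | τ < truncatedSecondMoment (X ω) M} with hQ
  have hQm : MeasurableSet Q :=
    measurableSet_lt measurable_const (measurable_truncatedSecondMoment hX M)
  set a := Real.sqrt ((m : ℝ) / n * τ) with ha
  have ha0 : 0 ≤ a := Real.sqrt_nonneg _
  let A (ω : Ω) : ℝ := sqrtStat u (X ω) - sqrtStat 1 (X ω)
  let B (v : ℝ) (ω : Ω) : ℝ := sqrtStat v ((X ω).map (truncEntry M))
  have hA (ω) : |A ω| ≤ u - 1 := abs_sqrtStat_sub_le (X ω) hu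
  have hB (ω) : |B u ω - B 1 ω| ≤ u - 1 := abs_sqrtStat_sub_le _ hu
  have hAm : Measurable A := (measurable_sqrtStat hu0 hX).sub (measurable_sqrtStat one_pos hX)
  have hAi : Integrable A P := Integrable.of_bound hAm.aestronglyMeasurable _ (ae_of_all _ hA)
  have hBL (v : ℝ) (hv : 0 < v) : MemLp (B v) 2 P := memLp_sqrtStat_trunc hX hv hM
  have hBi (v : ℝ) (hv : 0 < v) : Integrable (B v) P := (hBL v hv).integrable one_le_two
  have hclose (ω) (hω : ω ∉ Q) : |A ω - (B u ω - B 1 ω)| ≤ 2 * a := by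
    have hle : Real.sqrt ((m : ℝ) / n * truncatedSecondMoment (X ω) M) ≤ a :=
      Real.sqrt_le_sqrt (mul_le_mul_of_nonneg_left (not_lt.mp hω) (by positivity))
    have h1 := (abs_sqrtStat_sub_trunc_le hu0 (X ω) M).trans hle
    have h2 := (abs_sqrtStat_sub_trunc_le one_pos (X ω) M).trans hle
    simp only [A, B]
    rw [abs_le] at h1 h2 ⊢
    constructor <;> linarith
  -- Off `Q` the two differences are within `2 a`; on `Q` each is bounded by `u - 1`.
  have hmean : |∫ ω, A ω ∂P - (∫ ω, B u ω ∂P - ∫ ω, B 1 ω ∂P)|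
      ≤ 2 * a + 2 * (u - 1) * P.real Q := by
    have hBB : Integrable (fun ω => B u ω - B 1 ω) P := (hBi u hu0).sub (hBi 1 one_pos)
    rw [← integral_sub (hBi u hu0) (hBi 1 one_pos), ← integral_sub hAi hBB, ← Real.norm_eq_abs]
    have hI : Integrable (Q.indicator fun _ => 2 * (u - 1)) P :=
      (integrable_const _).indicator hQm
    have hgi : Integrable (fun ω => 2 * a + Q.indicator (fun _ => 2 * (u - 1)) ω) P :=
      (integrable_const _).add hI
    refine (norm_integral_le_of_norm_le hgi (ae_of_all _ fun ω => ?_)).trans_eq ?_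
    · rw [Real.norm_eq_abs]
      by_cases hω : ω ∈ Q
      · rw [Set.indicator_of_mem hω]
        have h1 := hA ω
        have h2 := hB ω
        rw [abs_le] at h1 h2 ⊢
        constructor <;> linarith
      · rw [Set.indicator_of_notMem hω, add_zero]
        exact hclose ω hω
    · rw [integral_add (integrable_const _) hI, integral_indicator_const _ hQm]
      simp [mul_comm]
  -- Outside the right-hand set the deviation is at most `2 a` pointwise, plus the error in the
  -- mean, plus two deviations of `η / 4`. By `hsmall` this is at most `3 η / 4`.
  have hsub : {ω | η < |A ω - ∫ ω', A ω' ∂P|} ⊆ Q ∪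
      ({ω | η / 4 ≤ |B u ω - ∫ ω', B u ω' ∂P|} ∪ {ω | η / 4 ≤ |B 1 ω - ∫ ω', B 1 ω' ∂P|}) := by
    intro ω hω
    by_contra hcon
    simp only [Set.mem_union, not_or, Set.mem_ofPred_eq, not_le] at hcon hω
    obtain ⟨h1, h2, h3⟩ := hcon
    have h4 := hclose ω h1
    refine absurd hω (not_lt.mpr ?_)
    rw [abs_lt] at h2 h3
    rw [abs_le] at h4 hmean ⊢
    constructor <;> linarith
  have hcheb (v : ℝ) (hv : 0 < v) : P {ω | η / 4 ≤ |B v ω - ∫ ω', B v ω' ∂P|}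
      ≤ ENNReal.ofReal (4 * M * (|d| / (n : ℝ) ^ 2) / (η / 4) ^ 2) := by
    refine (meas_ge_le_variance_div_sq (hBL v hv) (by positivity)).trans
      (ENNReal.ofReal_le_ofReal ?_)
    gcongr
    exact variance_sqrtStat_le hv hX hS hM
  refine (measure_mono hsub).trans ((measure_union_le _ _).trans ?_)
  gcongr
  refine (measure_union_le _ _).trans ?_
  rw [two_mul]
  exact add_le_add (hcheb u hu0) (hcheb 1 one_pos)

end OneMatrix

/-! ### From linear statistics to metrics for weak convergence -/

theorem ae_nonneg_iff_measure_Iio {μ : Measure ℝ} :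
    (∀ᵐ x ∂μ, 0 ≤ x) ↔ μ (Set.Iio 0) = 0 := by
  rw [ae_iff, show {x : ℝ | ¬ 0 ≤ x} = Set.Iio 0 from Set.ext fun x => not_le]

theorem ae_nonneg_of_tendsto {γ : Type*} {l : Filter γ} [l.NeBot] {ν : γ → ProbabilityMeasure ℝ}
    {μ : ProbabilityMeasure ℝ} (h : Tendsto ν l (𝓝 μ))
    (hν : ∀ j, ∀ᵐ x ∂(ν j : Measure ℝ), 0 ≤ x) : ∀ᵐ x ∂(μ : Measure ℝ), 0 ≤ x := by
  have h1 := ProbabilityMeasure.le_liminf_measure_open_of_tendsto h (isOpen_Iio (a := (0 : ℝ)))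
  have h2 (j : γ) : (ν j : Measure ℝ) (Set.Iio 0) = 0 :=
    ae_nonneg_iff_measure_Iio.mp (hν j)
  simp only [h2, liminf_const, nonpos_iff_eq_zero] at h1
  exact ae_nonneg_iff_measure_Iio.mpr h1

theorem ae_nonneg_meanMeasure {Ω : Type*} [MeasurableSpace Ω] (P : Measure Ω)
    [IsProbabilityMeasure P] (μ : Ω → ProbabilityMeasure ℝ) (hμ : Measurable μ)
    (h : ∀ ω, ∀ᵐ x ∂(μ ω : Measure ℝ), 0 ≤ x) :
    ∀ᵐ x ∂(meanMeasure P μ hμ : Measure ℝ), 0 ≤ x := by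
  have h2 (ω : Ω) : (μ ω : Measure ℝ) (Set.Iio 0) = 0 :=
    ae_nonneg_iff_measure_Iio.mp (h ω)
  have h1 := meanMeasure_apply P μ hμ (measurableSet_Iio (a := (0 : ℝ)))
  simp only [h2, lintegral_zero] at h1
  exact ae_nonneg_iff_measure_Iio.mpr h1

/-- If random probability measures on the half-line have tight means, and their linear statistics
concentrate for the functions `hypotDiff q`, then they are close to their means in probability, for
every metric for weak convergence. -/
theorem tendsto_measure_metric_gt {Ω : ℕ+ → Type*} [∀ n, MeasurableSpace (Ω n)]
    (P : ∀ n, Measure (Ω n)) [∀ n, IsProbabilityMeasure (P n)]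
    (L : ∀ n, Ω n → ProbabilityMeasure ℝ) (hL : ∀ n, Measurable (L n))
    (hpos : ∀ n ω, ∀ᵐ x ∂(L n ω : Measure ℝ), 0 ≤ x)
    (htight : ∀ δ : ℝ≥0∞, 0 < δ → ∃ K : ℝ, ∀ r, K ≤ r → ∀ᶠ n in atTop,
      (meanMeasure (P n) (L n) (hL n) : Measure ℝ) {x | r < ‖x‖} ≤ δ)
    (hconc : ∀ u : ℝ, 1 ≤ u → ∀ η : ℝ, 0 < η → Tendsto (fun n => P n {ω | η <
      |∫ x, hypotDiff u x ∂(L n ω : Measure ℝ)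
        - ∫ ω', ∫ x, hypotDiff u x ∂(L n ω' : Measure ℝ) ∂(P n)|}) atTop (𝓝 0))
    {ρ : ProbabilityMeasure ℝ → ProbabilityMeasure ℝ → ℝ} (hρ : MetrizesWeakConvergence ρ)
    {ε : ℝ} (hε : 0 < ε) :
    Tendsto (fun n => P n {ω | ε < ρ (L n ω) (meanMeasure (P n) (L n) (hL n))}) atTop (𝓝 0) := by
  rw [ENNReal.tendsto_nhds_zero]
  by_contra! hcon
  obtain ⟨δ, hδ, hfreq⟩ := hcon
  obtain ⟨e, he⟩ := exists_surjective_nat ℚ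
  let E (n : ℕ+) : ProbabilityMeasure ℝ := meanMeasure (P n) (L n) (hL n)
  -- Along infinitely many `n` the event of large distance has probability above `δ`, while the
  -- finitely many deviation events for `k ≤ j` have total probability below `δ` eventually. Some
  -- outcome thus has large distance but small deviations.
  have hpick (j : ℕ) : ∃ n : ℕ+, ∃ ω : Ω n, j ≤ (n : ℕ) ∧ ε < ρ (L n ω) (E n) ∧
      ∀ k ≤ j, (1 : ℝ) < e k → |∫ x, hypotDiff (e k) x ∂(L n ω : Measure ℝ)
        - ∫ x, hypotDiff (e k) x ∂(E n : Measure ℝ)| ≤ 1 / ((j : ℝ) + 1) := by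
    let S (k : ℕ) (n : ℕ+) : Set (Ω n) := {ω | (1 : ℝ) < e k ∧ 1 / ((j : ℝ) + 1) <
      |∫ x, hypotDiff (e k) x ∂(L n ω : Measure ℝ) - ∫ x, hypotDiff (e k) x ∂(E n : Measure ℝ)|}
    have hS (k : ℕ) : Tendsto (fun n => P n (S k n)) atTop (𝓝 0) := by
      by_cases hk : (1 : ℝ) < e k
      · have := hconc (e k) hk.le (1 / ((j : ℝ) + 1)) (by positivity)
        simpa only [S, hk, true_and, E, integral_meanMeasure] using this
      · simp [S, hk]
    have hsum : Tendsto (fun n => ∑ k ∈ Finset.range (j + 1), P n (S k n)) atTop (𝓝 0) := by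
      simpa using tendsto_finsetSum (Finset.range (j + 1)) fun k _ => hS k
    obtain ⟨n, hn, hn1, hn2⟩ := (hfreq.and_eventually
      ((hsum.eventually (gt_mem_nhds hδ)).and
        (eventually_ge_atTop (⟨j + 1, j.succ_pos⟩ : ℕ+)))).exists
    have hnot : ¬ {ω | ε < ρ (L n ω) (E n)} ⊆ ⋃ k ∈ Finset.range (j + 1), S k n := by
      intro hsubset
      have := (measure_mono hsubset).trans (measure_biUnion_finset_le (μ := P n) _ _)
      exact absurd (hn.trans_le this) (not_lt.mpr hn1.le)
    obtain ⟨ω, hω, hω'⟩ := Set.not_subset.mp hnot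
    refine ⟨n, ω, ?_, hω, fun k hk hek => ?_⟩
    · have : j + 1 ≤ (n : ℕ) := hn2
      omega
    · by_contra! hlt
      exact hω' (Set.mem_biUnion (Finset.mem_coe.mpr (Finset.mem_range.mpr (by omega)))
        ⟨hek, hlt⟩)
  choose N ω hN hωε hωq using hpick
  have hNtop : Tendsto N atTop atTop := by
    refine tendsto_atTop.mpr fun b => ?_
    filter_upwards [eventually_ge_atTop (b : ℕ)] with j hj
    exact PNat.coe_le_coe _ _ |>.mp (hj.trans (hN j))
  have hT : IsTightMeasureSet (Set.range fun j => (E (N j) : Measure ℝ)) := by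
    refine isTightMeasureSet_range_of_tendsto_limsup_measure_norm_gt ?_
    rw [ENNReal.tendsto_nhds_zero]
    intro δ' hδ'
    obtain ⟨K, hK⟩ := htight δ' hδ'
    filter_upwards [eventually_ge_atTop K] with r hr
    exact limsup_le_of_le (h := hNtop.eventually (hK r hr))
  have hcomp : IsCompact (closure (Set.range fun j => E (N j))) := by
    refine isCompact_closure_of_isTightMeasureSet (hT.subset ?_)
    rintro _ ⟨_, ⟨j, rfl⟩, rfl⟩
    exact ⟨j, rfl⟩
  obtain ⟨μ, -, φ, hφ, hμ⟩ := hcomp.isSeqCompact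
    (x := fun j => E (N j)) fun j => subset_closure ⟨j, rfl⟩
  have hμpos : ∀ᵐ x ∂(μ : Measure ℝ), 0 ≤ x :=
    ae_nonneg_of_tendsto hμ fun j => ae_nonneg_meanMeasure _ _ (hL _) (hpos _)
  -- Only the means need to be tight. Along the subsequence each statistic of the chosen outcomes
  -- has the same limit as that of the means, so the outcomes converge to `μ` too, which contradicts
  -- their distance from the means.
  have hLμ : Tendsto (fun j => L (N (φ j)) (ω (φ j))) atTop (𝓝 μ) := by
    refine tendsto_of_tendsto_integral_hypotDiff (fun j => hpos _ _) hμpos fun q hq => ?_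
    obtain ⟨k, rfl⟩ := he q
    have h1 := (ProbabilityMeasure.tendsto_iff_forall_integral_tendsto.mp hμ) (hypotDiff (e k))
    have h2 : Tendsto (fun j => ∫ x, hypotDiff (e k) x ∂(L (N (φ j)) (ω (φ j)) : Measure ℝ)
        - ∫ x, hypotDiff (e k) x ∂(E (N (φ j)) : Measure ℝ)) atTop (𝓝 0) := by
      refine squeeze_zero_norm' ?_
        ((tendsto_one_div_add_atTop_nhds_zero_nat (𝕜 := ℝ)).comp hφ.tendsto_atTop)
      filter_upwards [hφ.tendsto_atTop.eventually_ge_atTop k] with j hj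
      exact hωq (φ j) k hj hq
    simpa using h2.add h1
  have hd := ((hρ.tendsto_iff _ _).mp hLμ).add ((hρ.tendsto_iff _ _).mp hμ)
  rw [add_zero] at hd
  obtain ⟨j, hj⟩ := (hd.eventually (gt_mem_nhds hε)).exists
  have h1 := hωε (φ j)
  have h2 := hρ.triangle (L (N (φ j)) (ω (φ j))) μ (E (N (φ j)))
  rw [hρ.symm μ] at h2
  simp only [Function.comp_apply] at hj
  linarith

end

/-! ### Tightness and concentration under the hypotheses of the theorem -/

theorem exists_eventually_measure_truncatedSecondMoment_lt {Ω : ℕ+ → Type*}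
    [∀ n, MeasurableSpace (Ω n)] (P : ∀ n, Measure (Ω n)) {N : ℕ+ → ℕ}
    {X : ∀ n : ℕ+, Ω n → Matrix (Fin (n : ℕ)) (Fin (N n)) ℂ} {τ : ℝ}
    (hL : Tendsto (fun M : ℝ =>
      limsup (fun n : ℕ+ => P n {ω | τ < truncatedSecondMoment (X n ω) M}) atTop) atTop (𝓝 0))
    {δ : ℝ≥0∞} (hδ : 0 < δ) :
    ∃ M : ℝ, 0 ≤ M ∧ ∀ᶠ n in atTop, P n {ω | τ < truncatedSecondMoment (X n ω) M} < δ := by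
  obtain ⟨M, hM, hM0⟩ := ((hL.eventually (gt_mem_nhds hδ)).and (eventually_ge_atTop 0)).exists
  exact ⟨M, hM0, eventually_lt_of_limsup_lt hM⟩

theorem mainTheorem3 {Ω : ℕ+ → Type*} [∀ n, MeasurableSpace (Ω n)]
    (P : ∀ n, Measure (Ω n)) [∀ n, IsProbabilityMeasure (P n)]
    (N : ℕ+ → ℕ)
    (X : ∀ n : ℕ+, Ω n → Matrix (Fin (n : ℕ)) (Fin (N n)) ℂ)
    (hX : ∀ n i j, Measurable fun ω => X n ω i j)
    (d : ℕ+ → ℝ)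
    (hd : d =o[atTop] fun n : ℕ+ => ((n : ℕ) : ℝ) ^ 2)
    (hS : ∀ n, HasIndependentBlocks (P n) (X n) (d n))
    (c : ℝ) (hc : 0 < c)
    (hN : Tendsto (fun n : ℕ+ => ((n : ℕ) : ℝ) / (N n : ℝ)) atTop (𝓝 c))
    (hL : ∀ ε : ℝ, 0 < ε →
      Tendsto
        (fun M : ℝ =>
          limsup (fun n : ℕ+ => P n {ω | ε < truncatedSecondMoment (X n ω) M}) atTop)
        atTop (𝓝 0))
    (ρ : ProbabilityMeasure ℝ → ProbabilityMeasure ℝ → ℝ)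
    (hρ : MetrizesWeakConvergence ρ) :
    ∀ ε : ℝ, 0 < ε →
      Tendsto
        (fun n : ℕ+ => P n {ω | ε <
          ρ (singularESD (X n ω))
            (meanMeasure (P n) (fun ω' => singularESD (X n ω'))
              (measurable_singularESD (hX n)))})
        atTop (𝓝 0) := by
  intro ε hε
  obtain ⟨D, hD, hND⟩ : ∃ D : ℝ, 0 < D ∧ ∀ᶠ n : ℕ+ in atTop, (N n : ℝ) / ((n : ℕ) : ℝ) ≤ D := by
    refine ⟨c⁻¹ + 1, by positivity, ?_⟩
    have h := hN.inv₀ hc.ne'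
    simp only [inv_div] at h
    exact (h.eventually (gt_mem_nhds (lt_add_one _))).mono fun n hn => hn.le
  refine tendsto_measure_metric_gt P (fun n ω => singularESD (X n ω))
    (fun n => measurable_singularESD (hX n)) (fun n ω => ae_nonneg_singularESD (X n ω)) ?_ ?_ hρ hε
  -- Tightness of the means: where the truncated second moment is at most one, Markov's inequality
  -- bounds the tail by `D (M + 1) / r²`; elsewhere the trivial bound one costs at most `δ / 2`.
  · intro δ hδ
    obtain ⟨M, hM, hMδ⟩ := exists_eventually_measure_truncatedSecondMoment_lt P (hL 1 one_pos)
      (ENNReal.half_pos hδ.ne')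
    have hlim : Tendsto (fun r : ℝ => ENNReal.ofReal (D * (M + 1) / r ^ 2)) atTop (𝓝 0) := by
      rw [← ENNReal.ofReal_zero]
      exact ENNReal.tendsto_ofReal
        (tendsto_const_nhds.div_atTop (tendsto_pow_atTop two_ne_zero))
    obtain ⟨K, hK⟩ := eventually_atTop.mp
      ((hlim.eventually (gt_mem_nhds (ENNReal.half_pos hδ.ne'))).and (eventually_gt_atTop 0))
    refine ⟨K, fun r hr => ?_⟩
    obtain ⟨hr1, hr0⟩ := hK r hr
    filter_upwards [hMδ, hND] with n hn1 hn2
    have hQm : MeasurableSet {ω | 1 < truncatedSecondMoment (X n ω) M} :=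
      measurableSet_lt measurable_const (measurable_truncatedSecondMoment (hX n) M)
    rw [meanMeasure_apply _ _ _ (measurableSet_lt measurable_const measurable_norm)]
    calc ∫⁻ ω, (singularESD (X n ω) : Measure ℝ) {x | r < ‖x‖} ∂(P n)
        ≤ ∫⁻ ω, (ENNReal.ofReal (D * (M + 1) / r ^ 2)
            + {ω | 1 < truncatedSecondMoment (X n ω) M}.indicator 1 ω) ∂(P n) := by
          refine lintegral_mono fun ω => ?_
          by_cases hω : 1 < truncatedSecondMoment (X n ω) M
          · rw [Set.indicator_of_mem (show ω ∈ {ω | 1 < truncatedSecondMoment (X n ω) M} from hω)]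
            exact prob_le_one.trans le_add_self
          · refine ((measure_norm_gt_singularESD_le (X n ω) hM hr0).trans ?_).trans le_self_add
            refine ENNReal.ofReal_le_ofReal ?_
            have : M + truncatedSecondMoment (X n ω) M ≤ M + 1 := by linarith
            gcongr ?_ / _
            exact (mul_le_mul_of_nonneg_left this (by positivity)).trans
              (mul_le_mul_of_nonneg_right hn2 (by positivity))
      _ = ENNReal.ofReal (D * (M + 1) / r ^ 2)
            + P n {ω | 1 < truncatedSecondMoment (X n ω) M} := by
          rw [lintegral_add_left measurable_const, lintegral_indicator_one hQm]
          simp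
      _ ≤ δ / 2 + δ / 2 := add_le_add hr1.le hn1.le
      _ = δ := ENNReal.add_halves δ
  · intro u hu η hη
    rw [ENNReal.tendsto_nhds_zero]
    intro δ hδ
    -- The allowance `η / 4` in `measure_deviation_le` is split in two: `τ` makes the truncation
    -- error at most `η / 8`, and then `κ`, through the choice of `M`, makes the exceptional event
    -- contribute at most `2 u κ = η / 8`.
    obtain ⟨τ, hτ, hτη⟩ : ∃ τ : ℝ, 0 < τ ∧ 4 * Real.sqrt (D * τ) ≤ η / 8 := by
      refine ⟨(η / 32) ^ 2 / D, by positivity, ?_⟩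
      rw [mul_div_cancel₀ _ hD.ne', Real.sqrt_sq (by positivity)]
      linarith
    set κ : ℝ := η / (16 * u) with hκ
    have hκ0 : 0 < κ := by positivity
    have hmin : 0 < min (δ / 2) (ENNReal.ofReal κ) :=
      lt_min (ENNReal.half_pos hδ.ne') (ENNReal.ofReal_pos.mpr hκ0)
    obtain ⟨M, hM, hMδ⟩ := exists_eventually_measure_truncatedSecondMoment_lt P (hL τ hτ) hmin
    have hdlim : Tendsto (fun n : ℕ+ => 2 * ENNReal.ofReal
        (4 * M * (|d n| / ((n : ℕ) : ℝ) ^ 2) / (η / 4) ^ 2)) atTop (𝓝 0) := by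
      have h1 : Tendsto (fun n : ℕ+ => |d n| / ((n : ℕ) : ℝ) ^ 2) atTop (𝓝 0) := by
        have := hd.tendsto_div_nhds_zero.abs
        simpa [abs_div] using this
      have h2 := ENNReal.tendsto_ofReal ((h1.const_mul (4 * M)).div_const ((η / 4) ^ 2))
      have h3 := ENNReal.Tendsto.const_mul (a := 2) h2 (Or.inr ENNReal.ofNat_ne_top)
      simpa using h3
    filter_upwards [hMδ, hND, hdlim.eventually (gt_mem_nhds (ENNReal.half_pos hδ.ne'))]
      with n hn1 hn2 hn3
    have hreal : (P n).real {ω | τ < truncatedSecondMoment (X n ω) M} ≤ κ :=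
      ENNReal.toReal_le_of_le_ofReal hκ0.le (hn1.le.trans (min_le_right _ _))
    refine (measure_deviation_le (hX n) (hS n) hu hM (τ := τ) hη ?_).trans ?_
    · have h1 : Real.sqrt ((N n : ℝ) / ((n : ℕ) : ℝ) * τ) ≤ Real.sqrt (D * τ) := by gcongr
      have h2 : 2 * (u - 1) * (P n).real {ω | τ < truncatedSecondMoment (X n ω) M}
          ≤ 2 * u * κ := by
        have := measureReal_nonneg (μ := P n) (s := {ω | τ < truncatedSecondMoment (X n ω) M})
        gcongr
        linarith
      have h3 : 2 * u * κ = η / 8 := by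
        rw [hκ]
        field_simp
        norm_num
      linarith
    · calc _ ≤ δ / 2 + δ / 2 := add_le_add (hn1.le.trans (min_le_left _ _)) hn3.le
        _ = δ := ENNReal.add_halves δ
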